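/- Let $M$ and $W$ be disjoint sets of $n$ men and $n$ women, where every agent $i$ has a true preference list $\succ_i$, a strict total order on the agents of the other side. A matching is a bijection between $M$ and $W$; it is stable (with respect to $\succ$) if there is no pair $(m,w)$ who both strictly prefer each other to their partners. $\mathrm{DA}$ denotes the men-proposing deferred acceptance algorithm. A one-for-many manipulation game is given by such an instance, a set $P_m\subseteq M$ of strategic men, and for each $m\in P_m$ a set $P_w^m\subseteq W$ of beneficiary women. In a strategy profile $\mathbf p=(\mathbf p_m)_{m\in M}$ each $m\in P_m$ reports an arbitrary strict total order $\mathbf p_m$ on $W$, and all other men report truthfully, $\mathbf p_m=\succ_m$; all women report truthfully. Let $\mu_{\mathbf p}=\mathrm{DA}(\mathbf p,\succ_W)$. A one-for-many manipulation by $m\in P_m$ at $\mathbf p$ is a report $\mathbf p_m'$ such that, with $\mathbf p'=(\mathbf p_{-m},\mathbf p'_m)$ and with all comparisons made according to the true preferences, (i) every $w\in P_w^m$ weakly prefers $\mu_{\mathbf p'}$ to $\mu_{\mathbf p}$ and some $w'\in P_w^m$ strictly prefers $\mu_{\mathbf p'}$ to $\mu_{\mathbf p}$, and (ii) $m$ weakly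 prefers $\mu_{\mathbf p'}$ to $\mu_{\mathbf p}$. A strategy profile is a Nash equilibrium (NE) if no $m\in P_m$ has a one-for-many manipulation at it. Corollary. (a) There is an algorithm (one fixed random access machine program with unit-cost addition and subtraction) that, given any one-for-many manipulation game, outputs an NE profile of the game in time polynomial in $n$. (b) Every one-for-many manipulation game has an NE profile $\mathbf p$ such that $\mathrm{DA}(\mathbf p,\succ_W)$ is stable with respect to the true preferences $\succ$. -/

import Mathlib

/-! ### Matching instances and deferred acceptance -/

/-- The men of an instance with `n` men and `n` women. -/
abbrev Man (n : ℕ) : Type := Fin n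

/-- The women of an instance with `n` men and `n` women. -/
abbrev Woman (n : ℕ) : Type := Fin n

/-- A strict total order over the `n` agents of the other side, given as a preference list:
`l k` is the agent in position `k`, and position `0` is the most preferred one. -/
abbrev PrefList (n : ℕ) : Type := Equiv.Perm (Fin n)

/-- `a` is strictly preferred to `b`. -/
def PrefList.Prefers {n : ℕ} (l : PrefList n) (a b : Fin n) : Prop := l.symm a < l.symm b

/-- `a` is strictly preferred to `b`, or `a = b`. -/
def PrefList.WeaklyPrefers {n : ℕ} (l : PrefList n) (a b : Fin n) : Prop := l.symm a ≤ l.symm b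

instance {n : ℕ} (l : PrefList n) (a b : Fin n) : Decidable (l.Prefers a b) :=
  inferInstanceAs (Decidable (_ < _))

instance {n : ℕ} (l : PrefList n) (a b : Fin n) : Decidable (l.WeaklyPrefers a b) :=
  inferInstanceAs (Decidable (_ ≤ _))

/-- A (perfect) matching: man `m` is matched to `μ m`, woman `w` is matched to `μ.symm w`. -/
abbrev Matching (n : ℕ) : Type := Man n ≃ Woman n

/-- `(m, w)` is a blocking pair of `μ`: both prefer each other to their partners in `μ`. -/
def IsBlockingPair {n : ℕ} (men : Man n → PrefList n) (women : Woman n → PrefList n)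
    (μ : Matching n) (m : Man n) (w : Woman n) : Prop :=
  (men m).Prefers w (μ m) ∧ (women w).Prefers m (μ.symm w)

/-- A matching without blocking pairs. -/
def IsStable {n : ℕ} (men : Man n → PrefList n) (women : Woman n → PrefList n)
    (μ : Matching n) : Prop :=
  ∀ m w, ¬ IsBlockingPair men women μ m w

namespace DeferredAcceptance

variable {n : ℕ} (men : Man n → PrefList n) (women : Woman n → PrefList n)

/-- A state of the algorithm records for every man how many women have rejected him so far.
As he proposes in the order of his list, these are the first `rej m` women of his list, and
his current proposal (new, or tentatively accepted earlier) stands with the next one. -/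
def proposal (rej : Man n → ℕ) (m : Man n) : Option (Woman n) :=
  if h : rej m < n then some (men m ⟨rej m, h⟩) else none

/-- Man `m` is rejected in the current round: the woman `w` at whom his proposal stands also
has a proposal that she prefers. -/
def IsRejected (rej : Man n → ℕ) (m : Man n) : Prop :=
  ∃ w m', proposal men rej m = some w ∧ proposal men rej m' = some w ∧ (women w).Prefers m' m

instance (rej : Man n → ℕ) (m : Man n) : Decidable (IsRejected men women rej m) :=
  inferInstanceAs (Decidable (∃ _ _, _))

/-- One proposal phase followed by one rejection phase. -/
def round (rej : Man n → ℕ) : Man n → ℕ :=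
  fun m => if IsRejected men women rej m then rej m + 1 else rej m

/-- The final state. The bound of `n * n` rounds is never restrictive: no man is rejected in
it, see `not_isRejected_final`. -/
def final : Man n → ℕ := (round men women)^[n * n] fun _ => 0

/-- Every woman who has rejected `m` has a standing proposal that she prefers to `m`. -/
def Invariant (rej : Man n → ℕ) : Prop :=
  ∀ (m : Man n) (k : Fin n), (k : ℕ) < rej m →
    ∃ m', proposal men rej m' = some (men m k) ∧ (women (men m k)).Prefers m' m

theorem exists_best (rej : Man n → ℕ) (w : Woman n) (m : Man n)
    (h : proposal men rej m = some w) :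
    ∃ b, proposal men (round men women rej) b = some w ∧ (women w).WeaklyPrefers b m := by
  classical
  obtain ⟨b, hb, hmin⟩ := Finset.exists_min_image
    (Finset.univ.filter fun a => proposal men rej a = some w) (fun a => (women w).symm a)
    ⟨m, by simp [h]⟩
  simp only [Finset.mem_filter, Finset.mem_univ, true_and] at hb hmin
  refine ⟨b, ?_, hmin m h⟩
  have hn : ¬ IsRejected men women rej b := by
    rintro ⟨w', m', h1, h2, h3⟩
    rw [hb] at h1
    obtain rfl := Option.some.inj h1
    exact absurd (hmin m' h2) (not_le.mpr h3)
  have : round men women rej b = rej b := by simp [round, hn]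
  simpa [proposal, this] using hb

theorem invariant_round (rej : Man n → ℕ) (h : Invariant men women rej) :
    Invariant men women (round men women rej) := by
  intro m k hk
  have key : ∃ m', proposal men rej m' = some (men m k) ∧
      (women (men m k)).Prefers m' m := by
    by_cases hlt : (k : ℕ) < rej m
    · exact h m k hlt
    · by_cases hr : IsRejected men women rej m
      · have hk' : rej m = k := by simp [round, hr] at hk; omega
        obtain ⟨w, m', h1, h2, h3⟩ := hr
        have : w = men m k := by simpa [proposal, hk'] using h1.symm
        subst this
        exact ⟨m', h2, h3⟩
      · simp [round, hr] at hk; omega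
  obtain ⟨m', h1, h2⟩ := key
  obtain ⟨b, hb1, hb2⟩ := exists_best men women rej _ m' h1
  exact ⟨b, hb1, lt_of_le_of_lt hb2 h2⟩

theorem rej_lt (rej : Man n → ℕ) (h : Invariant men women rej) (m : Man n) : rej m < n := by
  by_contra hge
  have hall : ∀ w : Woman n, ∃ m', proposal men rej m' = some w ∧ (women w).Prefers m' m := by
    intro w
    have := h m ((men m).symm w) (by omega)
    simpa using this
  choose f hf1 hf2 using hall
  have hinj : Function.Injective f := by
    intro a b hab
    have h1 := hf1 a
    rw [hab, hf1 b] at h1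
    exact (Option.some.inj h1).symm
  obtain ⟨w, hw⟩ := Finite.surjective_of_injective hinj m
  have := hf2 w
  rw [hw] at this
  exact lt_irrefl _ this

theorem invariant_iterate (t : ℕ) :
    Invariant men women ((round men women)^[t] fun _ => 0) := by
  induction t with
  | zero => intro m k hk; simp at hk
  | succ t ih =>
    rw [Function.iterate_succ_apply']
    exact invariant_round men women _ ih

theorem sum_iterate (t : ℕ)
    (h : ∃ m, IsRejected men women ((round men women)^[t] fun _ => 0) m) :
    t ≤ ∑ m, ((round men women)^[t] fun _ => 0) m := by
  induction t with
  | zero => simp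
  | succ t ih =>
    set r := (round men women)^[t] fun _ => 0 with hr
    rw [Function.iterate_succ_apply', ← hr] at h ⊢
    by_cases hex : ∃ m, IsRejected men women r m
    · have h1 := ih hex
      obtain ⟨m, hm⟩ := hex
      have h2 : ∑ m, r m < ∑ m, round men women r m := by
        apply Finset.sum_lt_sum
        · intro i _; simp only [round]; split_ifs <;> omega
        · exact ⟨m, Finset.mem_univ _, by simp [round, hm]⟩
      omega
    · have : round men women r = r := by
        funext m
        simp only [round]
        rw [if_neg fun hm => hex ⟨m, hm⟩]
      rw [this] at h
      exact absurd h hex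

/-- The algorithm has terminated in the final state. -/
theorem not_isRejected_final (m : Man n) : ¬ IsRejected men women (final men women) m := by
  intro hm
  have h1 := sum_iterate men women (n * n) ⟨m, hm⟩
  have h2 : ∑ m, ((round men women)^[n * n] fun _ => 0) m < ∑ _m : Man n, n :=
    Finset.sum_lt_sum_of_nonempty ⟨m, Finset.mem_univ _⟩
      fun i _ => rej_lt men women _ (invariant_iterate men women _) i
  simp at h2
  omega

theorem final_lt (m : Man n) : final men women m < n :=
  rej_lt men women _ (invariant_iterate men women _) m

/-- The woman at whom the proposal of `m` stands in the final state. -/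
def partner (m : Man n) : Woman n := men m ⟨final men women m, final_lt men women m⟩

theorem proposal_final (m : Man n) :
    proposal men (final men women) m = some (partner men women m) := by
  simp [proposal, partner, final_lt men women m]

theorem partner_bijective : Function.Bijective (partner men women) := by
  rw [← Finite.injective_iff_bijective]
  intro a b hab
  by_contra hne
  have key : ∀ x y : Man n, partner men women x = partner men women y →
      ¬ (women (partner men women x)).Prefers x y := by
    intro x y hxy hp
    exact not_isRejected_final men women y
      ⟨partner men women x, x, by rw [proposal_final, hxy], proposal_final men women x, hp⟩
  have h1 := key a b hab
  have h2 := key b a hab.symm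
  rw [← hab] at h2
  unfold PrefList.Prefers at h1 h2
  exact hne ((women _).symm.injective (le_antisymm (not_lt.mp h2) (not_lt.mp h1)))

end DeferredAcceptance

/-- The outcome of the men-proposing deferred acceptance algorithm on the reported lists. -/
noncomputable def DA {n : ℕ} (men : Man n → PrefList n) (women : Woman n → PrefList n) :
    Matching n :=
  Equiv.ofBijective (DeferredAcceptance.partner men women)
    (DeferredAcceptance.partner_bijective men women)

/-! ### One-for-many manipulation games -/

/-- A one-for-many manipulation game: the true preferences of all agents, the set of strategic
men, and for every strategic man the set of his beneficiary women (the value of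
`beneficiaries` at the other men plays no role). -/
structure OneForManyGame (n : ℕ) where
  menPref : Man n → PrefList n
  womenPref : Woman n → PrefList n
  strategic : Finset (Man n)
  beneficiaries : Man n → Finset (Woman n)

namespace OneForManyGame

variable {n : ℕ} (G : OneForManyGame n)

/-- The matching produced by deferred acceptance when the men report `p` and the women report
truthfully. -/
noncomputable def outcome (p : Man n → PrefList n) : Matching n := DA p G.womenPref

/-- A strategy profile: the strategic men report any lists, the other men are truthful. -/
def IsStrategyProfile (p : Man n → PrefList n) : Prop :=
  ∀ m, m ∉ G.strategic → p m = G.menPref m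

/-- The report `l` is a one-for-many manipulation by man `m` at the profile `p`: the new matching
Pareto dominates the old one for the beneficiaries of `m`, and `m` is not worse off. Partners
are compared according to the true preferences. -/
def IsManipulation (p : Man n → PrefList n) (m : Man n) (l : PrefList n) : Prop :=
  let μ := G.outcome p
  let ν := G.outcome (Function.update p m l)
  (∀ w ∈ G.beneficiaries m, (G.womenPref w).WeaklyPrefers (ν.symm w) (μ.symm w)) ∧
  (∃ w ∈ G.beneficiaries m, (G.womenPref w).Prefers (ν.symm w) (μ.symm w)) ∧
  (G.menPref m).WeaklyPrefers (ν m) (μ m)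

/-- A Nash equilibrium: a strategy profile at which no strategic man has a one-for-many
manipulation. -/
def IsNashEquilibrium (p : Man n → PrefList n) : Prop :=
  G.IsStrategyProfile p ∧ ∀ m ∈ G.strategic, ∀ l : PrefList n, ¬ G.IsManipulation p m l

/-- The input word of a game: `n`, the lists of the men, the lists of the women (row by row),
the indicator vector of the strategic men, the indicator matrix of the beneficiaries. -/
def encode : List ℕ :=
  n :: (List.ofFn (fun i : Fin (n * n) => (G.menPref i.divNat i.modNat : ℕ)) ++
    List.ofFn (fun i : Fin (n * n) => (G.womenPref i.divNat i.modNat : ℕ)) ++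
    List.ofFn (fun m : Fin n => if m ∈ G.strategic then 1 else 0) ++
    List.ofFn (fun i : Fin (n * n) => if i.modNat ∈ G.beneficiaries i.divNat then 1 else 0))

end OneForManyGame

/-- The output word of a profile: the lists of the men, row by row. -/
def encodeProfile {n : ℕ} (p : Man n → PrefList n) : List ℕ :=
  List.ofFn (fun i : Fin (n * n) => (p i.divNat i.modNat : ℕ))

/-! ### Random access machines -/

namespace RAM

/-- Programs of a random access machine with the usual control structures. A program mentions
finitely many registers, and it accesses an unbounded memory of natural numbers by indirect
addressing. The only arithmetic is addition and (truncated) subtraction, so that unit-cost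
polynomial time agrees with polynomial time on Turing machines. -/
inductive Program : Type
  /-- `x := c` -/
  | const (x c : ℕ)
  /-- `x := y + z` -/
  | add (x y z : ℕ)
  /-- `x := y - z` -/
  | sub (x y z : ℕ)
  /-- `x := memory[y]` -/
  | load (x y : ℕ)
  /-- `memory[x] := y` -/
  | store (x y : ℕ)
  /-- first `c`, then `d` -/
  | seq (c d : Program)
  /-- `if x < y then c else d` -/
  | ite (x y : ℕ) (c d : Program)
  /-- `while x < y do c` -/
  | while (x y : ℕ) (c : Program)

/-- The contents of the registers and of the memory. -/
structure State where
  reg : ℕ → ℕ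
  mem : ℕ → ℕ

def State.setReg (s : State) (x v : ℕ) : State := { s with reg := Function.update s.reg x v }

def State.setMem (s : State) (a v : ℕ) : State := { s with mem := Function.update s.mem a v }

/-- `Exec c s t u`: started in state `s`, the program `c` halts after exactly `t` steps, in
state `u`. Every instruction and every evaluation of a test is one step. -/
inductive Exec : Program → State → ℕ → State → Prop
  | const (s x c) : Exec (.const x c) s 1 (s.setReg x c)
  | add (s x y z) : Exec (.add x y z) s 1 (s.setReg x (s.reg y + s.reg z))
  | sub (s x y z) : Exec (.sub x y z) s 1 (s.setReg x (s.reg y - s.reg z))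
  | load (s x y) : Exec (.load x y) s 1 (s.setReg x (s.mem (s.reg y)))
  | store (s x y) : Exec (.store x y) s 1 (s.setMem (s.reg x) (s.reg y))
  | seq {c d s t u t' v} : Exec c s t u → Exec d u t' v → Exec (.seq c d) s (t + t') v
  | iteTrue {x y c d s t u} : s.reg x < s.reg y → Exec c s t u →
      Exec (.ite x y c d) s (t + 1) u
  | iteFalse {x y c d s t u} : ¬ s.reg x < s.reg y → Exec d s t u →
      Exec (.ite x y c d) s (t + 1) u
  | whileTrue {x y c s t u t' v} : s.reg x < s.reg y → Exec c s t u →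
      Exec (.while x y c) u t' v → Exec (.while x y c) s (t + t' + 1) v
  | whileFalse {x y c s} : ¬ s.reg x < s.reg y → Exec (.while x y c) s 1 s

/-- The initial state: the input is in the first memory cells, all else is `0`. -/
def initial (input : List ℕ) : State where
  reg := fun _ => 0
  mem := fun i => input.getD i 0

/-- The output word is in the first memory cells. -/
def State.HasOutput (s : State) (output : List ℕ) : Prop :=
  ∀ (i : ℕ) (h : i < output.length), s.mem i = output[i]

end RAM

/-- The search problem "given a one-for-many game `G` with `n` men and `n` women, find a profile
`p` with `R n G p`" is solved in time polynomial in `n`, by one program for all `n`. (The input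
consists of `3 * n ^ 2 + n + 1` numbers, none larger than `max n 1`, so this is the same
as polynomial in the length of the input.) -/
def ComputableInPolyTime
    (R : (n : ℕ) → OneForManyGame n → (Man n → PrefList n) → Prop) : Prop :=
  ∃ (c : RAM.Program) (q : Polynomial ℕ), ∀ (n : ℕ) (G : OneForManyGame n),
    ∃ (t : ℕ) (s : RAM.State) (p : Man n → PrefList n),
      RAM.Exec c (RAM.initial G.encode) t s ∧ t ≤ q.eval n ∧
      s.HasOutput (encodeProfile p) ∧ R n G p

/-! Start from the truthful profile and let a strategic man raise a woman from below his partner to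
the front of his list, keeping the change only if his partner stays the same. The new matching is
then stable for the profile before the move. By men-optimality every other man descends weakly in
his list, and the mover has exactly one more woman above his partner (`progressive_attempt`). The
sum of these numbers is at most `n * n`, so `n * n` sweeps over all moves reach a profile where no
move is left.

Along the way lists deviate from the truth only above the partners (`TruthfulBelow`). Hence a woman
truly preferred to the partner is also reported above him or her rivals there, and stability for the
reports gives stability for the true preferences.

At the end nobody can manipulate. By strategyproofness a manipulator who is not worse off keeps his
partner. If his new list put a woman above that partner who was below before, then raising her to
the front must have failed, that is, must have won her for him; so the new list would violate
strategyproofness. Hence the old matching is stable for the new profile too, and since deferred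
acceptance is pessimal for women, no woman gains. The tools are the blocking lemma
`exists_isBlockingPair` and its consequences.

For the running time, deferred acceptance is replaced by single rejections in arbitrary order
(`iterate_rejectSweep`), and everything is written in a small language whose loops all have `n`
rounds, so that compiled programs are polynomial by construction (`Stmt.exec_compile`). -/

namespace DeferredAcceptance

/-! ### Stability, optimality and strategyproofness of deferred acceptance -/

variable {n : ℕ} (men : Man n → PrefList n) (women : Woman n → PrefList n)

theorem DA_apply (m : Man n) : DA men women m = partner men women m := rfl

theorem symm_DA_apply (m : Man n) : ((men m).symm (DA men women m) : ℕ) = final men women m := by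
  simp [DA_apply, partner]

theorem DA_eq_of_proposal_final {m : Man n} {w : Woman n}
    (h : proposal men (final men women) m = some w) : DA men women m = w := by
  rw [proposal_final] at h
  exact Option.some.inj h

theorem proposal_eq_some_iff {rej : Man n → ℕ} {m : Man n} {w : Woman n} :
    proposal men rej m = some w ↔ ((men m).symm w : ℕ) = rej m := by
  unfold proposal
  split_ifs with h
  · rw [Option.some_inj, ← Equiv.eq_symm_apply, Fin.ext_iff]
    exact eq_comm
  · have := ((men m).symm w).isLt
    simp only [false_iff]
    omega

/-- The women above the partner of `m` have rejected him, so `Invariant` at the final state applies.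
-/
theorem prefers_symm_DA {m : Man n} {w : Woman n} (h : (men m).Prefers w (DA men women m)) :
    (women w).Prefers ((DA men women).symm w) m := by
  have hlt : ((men m).symm w : ℕ) < final men women m := by
    rw [← symm_DA_apply men women m]; exact h
  obtain ⟨b, hb, hp⟩ := invariant_iterate men women (n * n) m ((men m).symm w) hlt
  rw [Equiv.apply_symm_apply] at hb hp
  rwa [← DA_eq_of_proposal_final men women hb, Equiv.symm_apply_apply,
    DA_eq_of_proposal_final men women hb]

theorem isStable_DA : IsStable men women (DA men women) := fun _ _ h =>
  lt_asymm h.2 (prefers_symm_DA men women h.1)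

theorem exists_not_isRejected (rej : Man n → ℕ) {w : Woman n} {m : Man n}
    (h : proposal men rej m = some w) :
    ∃ b, proposal men rej b = some w ∧ ¬ IsRejected men women rej b ∧
      (women w).WeaklyPrefers b m := by
  classical
  obtain ⟨b, hb, hmin⟩ := Finset.exists_min_image
    (Finset.univ.filter fun a => proposal men rej a = some w) (fun a => (women w).symm a)
    ⟨m, by simp [h]⟩
  simp only [Finset.mem_filter, Finset.mem_univ, true_and] at hb hmin
  refine ⟨b, hb, ?_, hmin m h⟩
  rintro ⟨w', m', h1, h2, h3⟩
  rw [hb] at h1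
  obtain rfl := Option.some.inj h1
  exact absurd (hmin m' h2) (not_le.mpr h3)

theorem round_le (rej : Man n → ℕ) (m : Man n) : rej m ≤ round men women rej m := by
  unfold round; split_ifs <;> omega

theorem monotone_iterate_round (m : Man n) :
    Monotone fun t => ((round men women)^[t] fun _ => 0) m := by
  refine monotone_nat_of_le_succ fun t => ?_
  rw [Function.iterate_succ_apply']
  exact round_le men women _ m

/-- The blocking lemma: if some man prefers a matching to the outcome of deferred acceptance,
then a man who does not is part of a blocking pair. -/
theorem exists_isBlockingPair (μ : Matching n) {m : Man n}
    (hm : (men m).Prefers (μ m) (DA men women m)) :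
    ∃ c y, IsBlockingPair men women μ c y ∧ ¬ (men c).Prefers (μ c) (DA men women c) := by
  classical
  -- Call a man a gainer if he prefers `μ`. If deferred acceptance gives the woman `μ a` of a gainer
  -- `a` to a man who is no gainer, then these two block `μ`.
  by_cases hcase : ∃ a, (men a).Prefers (μ a) (DA men women a) ∧
      ¬ (men ((DA men women).symm (μ a))).Prefers (μ ((DA men women).symm (μ a))) (μ a)
  · obtain ⟨a, ha, hc⟩ := hcase
    refine ⟨(DA men women).symm (μ a), μ a, ⟨?_, ?_⟩, by rwa [Equiv.apply_symm_apply]⟩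
    · refine lt_of_le_of_ne (not_lt.mp hc) fun he => ?_
      have h1 : (DA men women).symm (μ a) = a :=
        (μ.injective ((men _).symm.injective he)).symm
      have h2 : DA men women a = μ a := by
        rw [← h1, Equiv.apply_symm_apply, h1]
      rw [h2] at ha
      exact lt_irrefl _ ha
    · rw [Equiv.symm_apply_apply]
      exact prefers_symm_DA men women ha
  push Not at hcase
  set S : Finset (Man n) := Finset.univ.filter fun a => (men a).Prefers (μ a) (DA men women a)
    with hS
  have memS : ∀ a, a ∈ S ↔ (men a).Prefers (μ a) (DA men women a) := by simp [hS]
  have hmaps : Set.MapsTo (fun a => (DA men women).symm (μ a)) S S := by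
    intro a ha
    have := hcase a ((memS a).1 ha)
    simp only [Finset.mem_coe, memS, Equiv.apply_symm_apply]
    exact this
  -- Otherwise the gainers hold the same set of women in both matchings.
  have hsurj : Set.SurjOn (fun a => (DA men women).symm (μ a)) S S :=
    Finset.surjOn_of_injOn_of_card_le _ hmaps
      (fun a _ b _ hab => μ.injective ((DA men women).symm.injective hab)) le_rfl
  set r : ℕ → Man n → ℕ := fun t => (round men women)^[t] fun _ => 0 with hr
  have hrs : ∀ t, r (t + 1) = round men women (r t) := fun t =>
    Function.iterate_succ_apply' _ _ _
  have hrle : ∀ t m, t ≤ n * n → r t m ≤ final men women m := fun t m ht =>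
    monotone_iterate_round men women m ht
  have hend : ∃ t, ∀ a ∈ S, r t a = final men women a := ⟨n * n, fun _ _ => rfl⟩
  have hpos : ∀ a ∈ S, ((men a).symm (μ a) : ℕ) < final men women a := by
    intro a ha
    rw [← symm_DA_apply]
    exact (memS a).1 ha
  -- Round `t` is the last one in which a gainer is rejected; there is one because `m` is rejected
  -- at least once.
  obtain ⟨t, ht⟩ : ∃ t, Nat.find hend = t + 1 := by
    refine Nat.exists_eq_succ_of_ne_zero fun h0 => ?_
    have h1 := Nat.find_spec hend m ((memS m).2 hm)
    rw [h0] at h1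
    have h2 := hpos m ((memS m).2 hm)
    rw [← h1] at h2
    simp [hr] at h2
  have htle : t + 1 ≤ n * n := ht ▸ Nat.find_min' hend fun _ _ => rfl
  have hdone : ∀ a ∈ S, r (t + 1) a = final men women a := ht ▸ Nat.find_spec hend
  have hnot := Nat.find_min hend (m := t) (by omega)
  push Not at hnot
  obtain ⟨a, haS, ha⟩ := hnot
  have hrej : IsRejected men women (r t) a := by
    by_contra hne
    apply ha
    rw [← hdone a haS, hrs]
    simp [round, hne]
  obtain ⟨b, hbS, hb⟩ := hsurj haS
  have hb' : μ b = DA men women a := by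
    rw [← hb, Equiv.apply_symm_apply]
  -- The last rejected gainer `a` ends with `μ b`, who has turned down the gainer `b` by then. So in
  -- round `t` she has a suitor better than `b`. The best one, `c`, survives the round but loses her
  -- to `a` later, hence is no gainer, and blocks `μ` with her.
  have hkey : ∃ c, proposal men (r t) c = some (μ b) ∧ (women (μ b)).Prefers c b := by
    have hlt := hpos b hbS
    rw [← hdone b hbS, hrs] at hlt
    by_cases hlt' : ((men b).symm (μ b) : ℕ) < r t b
    · have := invariant_iterate men women t b _ hlt'
      rwa [Equiv.apply_symm_apply] at this
    · by_cases hbr : IsRejected men women (r t) b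
      · have heq : ((men b).symm (μ b) : ℕ) = r t b := by
          simp only [round, hbr, if_true] at hlt; omega
        obtain ⟨w, c, h1, h2, h3⟩ := hbr
        rw [proposal_eq_some_iff] at h1
        have : w = μ b := (men b).symm.injective (Fin.ext (h1.trans heq.symm))
        subst this
        exact ⟨c, h2, h3⟩
      · simp only [round, hbr, if_false] at hlt; omega
  obtain ⟨c₀, hc₀, hc₀b⟩ := hkey
  obtain ⟨c, hc, hcn, hcc⟩ := exists_not_isRejected men women (r t) hc₀
  have hca : c ≠ a := fun h => hcn (h ▸ hrej)
  have hc1 : ((men c).symm (μ b) : ℕ) = r (t + 1) c := by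
    rw [hrs, (proposal_eq_some_iff men).1 hc]
    simp [round, hcn]
  have hlt : ((men c).symm (μ b) : ℕ) < final men women c := by
    refine lt_of_le_of_ne (hc1 ▸ hrle _ c htle) fun he => hca ?_
    have := DA_eq_of_proposal_final men women ((proposal_eq_some_iff men).2 he)
    exact (DA men women).injective (this.trans hb')
  have hcS : c ∉ S := fun h => by
    have := hdone c h
    omega
  rw [memS] at hcS
  refine ⟨c, μ b, ⟨?_, ?_⟩, hcS⟩
  · have : final men women c ≤ ((men c).symm (μ c) : ℕ) := by
      rw [← symm_DA_apply]
      exact not_lt.mp hcS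
    exact Fin.lt_def.2 (lt_of_lt_of_le hlt this)
  · rw [Equiv.symm_apply_apply]
    exact lt_of_le_of_lt hcc hc₀b

variable {men women} in
/-- Deferred acceptance is optimal for the men among all stable matchings. -/
theorem not_prefers_of_isStable {μ : Matching n} (h : IsStable men women μ) (m : Man n) :
    ¬ (men m).Prefers (μ m) (DA men women m) := fun hm =>
  let ⟨c, y, hb, _⟩ := exists_isBlockingPair men women μ hm
  h c y hb

variable {men women} in
/-- Deferred acceptance is pessimal for the women among all stable matchings. -/
theorem weaklyPrefers_of_isStable {μ : Matching n} (h : IsStable men women μ) (w : Woman n) :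
    (women w).WeaklyPrefers (μ.symm w) ((DA men women).symm w) := by
  by_contra hw
  refine h ((DA men women).symm w) w ⟨?_, not_le.mp hw⟩
  have h1 := not_lt.mp (not_prefers_of_isStable h ((DA men women).symm w))
  rw [Equiv.apply_symm_apply] at h1
  refine lt_of_le_of_ne h1 fun he => hw ?_
  have h2 := (men _).symm.injective he
  rw [Equiv.eq_symm_apply μ |>.2 h2.symm]
  exact le_refl _

/-- Deferred acceptance is strategyproof for every single man. -/
theorem not_prefers_DA_update (m : Man n) (l : PrefList n) :
    ¬ (men m).Prefers (DA (Function.update men m l) women m) (DA men women m) := by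
  intro hm
  obtain ⟨c, y, hb, hc⟩ := exists_isBlockingPair men women _ hm
  -- The blocking man is not `m`, so his list is the same in both profiles and the pair also blocks
  -- under the misreport.
  have hcm : c ≠ m := fun h => hc (h ▸ hm)
  refine isStable_DA (Function.update men m l) women c y ⟨?_, hb.2⟩
  rw [Function.update_of_ne hcm]
  exact hb.1

/-! ### Rejections one at a time -/

open Classical in
/-- Man `m` is rejected if his proposal stands with the same woman as the one of `m'`, and she
prefers `m'`. -/
noncomputable def reject (m m' : Man n) (rej : Man n → ℕ) : Man n → ℕ :=
  if ∃ w, proposal men rej m = some w ∧ proposal men rej m' = some w ∧ (women w).Prefers m' m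
  then Function.update rej m (rej m + 1) else rej

/-- The states that are reached by rejections in any order. -/
def Reachable (rej : Man n → ℕ) : Prop := Invariant men women rej ∧ rej ≤ final men women

theorem reachable_zero : Reachable men women fun _ => 0 :=
  ⟨fun _ _ h => absurd h (Nat.not_lt_zero _), fun _ => Nat.zero_le _⟩

variable {men women} in
theorem Reachable.lt {rej : Man n → ℕ} (h : Reachable men women rej) (m : Man n) : rej m < n :=
  rej_lt men women rej h.1 m

variable {men women} in
-- No order of rejections overshoots: a man standing at his final partner cannot lose her, since a
-- rival she prefers either ends with her too or is rejected for someone she likes even more.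
theorem Reachable.reject {rej : Man n → ℕ} (h : Reachable men women rej) (m m' : Man n) :
    Reachable men women (reject men women m m' rej) := by
  unfold DeferredAcceptance.reject
  split_ifs with hw
  swap
  · exact h
  obtain ⟨w, h1, h2, h3⟩ := hw
  have hR : IsRejected men women rej m := ⟨w, m', h1, h2, h3⟩
  constructor
  · intro a k hk
    have key : ∃ c, proposal men rej c = some (men a k) ∧
        (women (men a k)).Prefers c a := by
      by_cases hlt : (k : ℕ) < rej a
      · exact h.1 a k hlt
      · obtain rfl : a = m := by
          by_contra hne
          rw [Function.update_of_ne hne] at hk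
          exact hlt hk
        rw [Function.update_self] at hk
        have : w = men a k := by
          rw [proposal_eq_some_iff] at h1
          rw [← Equiv.symm_apply_eq]
          exact Fin.ext (by omega)
        subst this
        exact ⟨m', h2, h3⟩
    obtain ⟨c₀, hc₀, hc₀a⟩ := key
    obtain ⟨c, hc, hcn, hcc⟩ := exists_not_isRejected men women rej hc₀
    have hcm : c ≠ m := fun h => hcn (h ▸ hR)
    refine ⟨c, ?_, lt_of_le_of_lt hcc hc₀a⟩
    rw [proposal_eq_some_iff] at hc ⊢
    rw [Function.update_of_ne hcm, hc]
  · intro a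
    by_cases ham : a = m
    swap
    · rw [Function.update_of_ne ham]; exact h.2 a
    subst ham
    rw [Function.update_self]
    refine Nat.succ_le_of_lt (lt_of_le_of_ne (h.2 a) fun he => ?_)
    rw [proposal_eq_some_iff] at h1 h2
    have hDA : DA men women a = w :=
      DA_eq_of_proposal_final men women ((proposal_eq_some_iff men).2 (h1.trans he))
    rcases (h.2 m').lt_or_eq with hlt | heq
    · have hp : (men m').Prefers w (DA men women m') := by
        refine Fin.lt_def.2 ?_
        rw [symm_DA_apply, h2]
        exact hlt
      have := prefers_symm_DA men women hp
      rw [← hDA, Equiv.symm_apply_apply, hDA] at this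
      exact lt_asymm h3 this
    · have hDA' : DA men women m' = w :=
        DA_eq_of_proposal_final men women ((proposal_eq_some_iff men).2 (h2.trans heq))
      rw [(DA men women).injective (hDA.trans hDA'.symm)] at h3
      exact lt_irrefl _ h3

variable {men women} in
-- Without collisions the proposals form a matching, stable by `Invariant`. Men-optimality of
-- deferred acceptance then gives `final ≤ rej`.
theorem Reachable.eq_final {rej : Man n → ℕ} (h : Reachable men women rej)
    (hn : ∀ m m', DeferredAcceptance.reject men women m m' rej = rej) :
    rej = final men women := by
  have hnr : ∀ m m' w, proposal men rej m = some w → proposal men rej m' = some w →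
      ¬ (women w).Prefers m' m := by
    intro m m' w h1 h2 h3
    have := congrFun (hn m m') m
    unfold DeferredAcceptance.reject at this
    rw [if_pos ⟨w, h1, h2, h3⟩, Function.update_self] at this
    omega
  have hprop : ∀ m, proposal men rej m = some (men m ⟨rej m, h.lt m⟩) := by
    intro m
    simp [proposal, h.lt m]
  have hinj : Function.Injective fun m => men m ⟨rej m, h.lt m⟩ := by
    intro a b hab
    have hb := hprop b
    rw [← show men a ⟨rej a, h.lt a⟩ = men b ⟨rej b, h.lt b⟩ from hab] at hb
    exact (women _).symm.injective
      (le_antisymm (not_lt.mp (hnr _ _ _ (hprop a) hb)) (not_lt.mp (hnr _ _ _ hb (hprop a))))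
  set μ : Matching n := Equiv.ofBijective _ (Finite.injective_iff_bijective.1 hinj) with hμ
  have hμa : ∀ m, μ m = men m ⟨rej m, h.lt m⟩ := fun _ => rfl
  have hst : IsStable men women μ := by
    intro m w hb
    have hlt : ((men m).symm w : ℕ) < rej m := by
      have := Fin.lt_def.1 hb.1
      rwa [hμa, Equiv.symm_apply_apply] at this
    obtain ⟨c, hc, hcm⟩ := h.1 m _ hlt
    rw [Equiv.apply_symm_apply] at hc hcm
    rw [hprop c, Option.some_inj, ← hμa] at hc
    have := hb.2
    rw [← hc, Equiv.symm_apply_apply, hc] at this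
    exact lt_asymm this hcm
  funext m
  refine le_antisymm (h.2 m) ?_
  have := not_lt.mp (not_prefers_of_isStable hst m)
  have := Fin.le_def.1 this
  rwa [symm_DA_apply, hμa, Equiv.symm_apply_apply] at this

end DeferredAcceptance

/-! ### Loops that make progress -/

/-- `f 0`, ..., `f (k - 1)` are applied one after the other. -/
def forLoop {α : Type*} (f : ℕ → α → α) : ℕ → α → α
  | 0, x => x
  | k + 1, x => f k (forLoop f k x)

/-- The loop over all elements of `Fin n`. -/
def finLoop {α : Type*} {n : ℕ} (f : Fin n → α → α) : α → α :=
  forLoop (fun i x => if h : i < n then f ⟨i, h⟩ x else x) n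

/-- A loop simulates an iteration if its body simulates one step. -/
theorem forLoop_simulation_iterate {α β : Type*} {f : α → α} {g : ℕ → β → β}
    (R : α → β → Prop) (h : ∀ i x y, R x y → R (f x) (g i y)) (k : ℕ) {x : α} {y : β}
    (hxy : R x y) : R (f^[k] x) (forLoop g k y) := by
  induction k with
  | zero => exact hxy
  | succ k ih =>
    rw [Function.iterate_succ_apply']
    exact h k _ _ ih

theorem forLoop_const {α : Type*} (f : α → α) (k : ℕ) : forLoop (fun _ => f) k = f^[k] := by
  funext x
  induction k with
  | zero => rfl
  | succ k ih => rw [Function.iterate_succ_apply', ← ih]; rfl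

/-- An invariant of a loop. -/
theorem forLoop_induction {α : Type*} {f : ℕ → α → α} {k : ℕ} {x : α} (P : ℕ → α → Prop)
    (h0 : P 0 x) (hs : ∀ i < k, ∀ y, P i y → P (i + 1) (f i y)) : P k (forLoop f k x) := by
  induction k with
  | zero => exact h0
  | succ k ih => exact hs k (Nat.lt_succ_self k) _ (ih fun i hi => hs i (by omega))

/-- A loop simulates another one if its body does. -/
theorem finLoop_simulation {α β : Type*} {n : ℕ} {f : Fin n → α → α} {g : ℕ → β → β}
    (R : α → β → Prop) (h : ∀ i x y, R x y → R (f i x) (g i y)) {x : α} {y : β} (hxy : R x y) :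
    R (finLoop f x) (forLoop g n y) := by
  suffices ∀ k ≤ n, R (forLoop (fun i x => if h : i < n then f ⟨i, h⟩ x else x) k x)
      (forLoop g k y) from this n le_rfl
  intro k hk
  induction k with
  | zero => exact hxy
  | succ k ih =>
    have := h ⟨k, hk⟩ _ _ (ih (by omega))
    simpa only [forLoop, dif_pos (show k < n from hk)] using this

/-- `f` preserves `P`, and it increases `Φ` wherever it is not the identity. -/
def Progressive {α : Type*} (P : α → Prop) (Φ : α → ℕ) (f : α → α) : Prop :=
  ∀ x, P x → P (f x) ∧ (f x = x ∨ Φ x < Φ (f x))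

namespace Progressive

variable {α : Type*} {P : α → Prop} {Φ : α → ℕ}

theorem le {f : α → α} (h : Progressive P Φ f) {x : α} (hx : P x) : Φ x ≤ Φ (f x) := by
  rcases (h x hx).2 with h | h
  · rw [h]
  · exact h.le

theorem comp {f g : α → α} (hf : Progressive P Φ f) (hg : Progressive P Φ g) :
    Progressive P Φ fun x => f (g x) := by
  intro x hx
  refine ⟨(hf _ (hg x hx).1).1, ?_⟩
  have h1 := hf.le (hg x hx).1
  rcases (hg x hx).2 with h | h
  · simp only [h]
    exact (hf x hx).2
  · exact Or.inr (lt_of_lt_of_le h h1)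

theorem forLoop {f : ℕ → α → α} (h : ∀ i, Progressive P Φ (f i)) (k : ℕ) :
    Progressive P Φ (forLoop f k) := by
  induction k with
  | zero => exact fun x hx => ⟨hx, Or.inl rfl⟩
  | succ k ih => exact (h k).comp ih

/-- A potential that has risen never falls back, so a loop that returns to its start has not moved
at all. -/
theorem eq_of_forLoop_eq {f : ℕ → α → α} (h : ∀ i, Progressive P Φ (f i)) {k : ℕ} {x : α}
    (hx : P x) (hfix : _root_.forLoop f k x = x) : ∀ i < k, f i x = x := by
  induction k with
  | zero => intro i hi; omega
  | succ k ih =>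
    have hk := Progressive.forLoop h k x hx
    have hfix' : f k (_root_.forLoop f k x) = x := hfix
    have hle := (h k).le hk.1
    rw [hfix'] at hle
    have heq : _root_.forLoop f k x = x := hk.2.resolve_right (by omega)
    intro i hi
    rcases Nat.lt_succ_iff_lt_or_eq.1 hi with hi | rfl
    · exact ih heq i hi
    · rwa [heq] at hfix'

theorem dite {n : ℕ} {f : Fin n → α → α} (h : ∀ i, Progressive P Φ (f i)) (i : ℕ) :
    Progressive P Φ (fun x => if h : i < n then f ⟨i, h⟩ x else x) := by
  by_cases hi : i < n
  · simpa only [dif_pos hi] using h ⟨i, hi⟩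
  · simp only [dif_neg hi]
    exact fun x hx => ⟨hx, Or.inl rfl⟩

theorem finLoop {n : ℕ} {f : Fin n → α → α} (h : ∀ i, Progressive P Φ (f i)) :
    Progressive P Φ (finLoop f) :=
  Progressive.forLoop (Progressive.dite h) n

theorem eq_of_finLoop_eq {n : ℕ} {f : Fin n → α → α} (h : ∀ i, Progressive P Φ (f i)) {x : α}
    (hx : P x) (hfix : _root_.finLoop f x = x) (i : Fin n) : f i x = x := by
  have := eq_of_forLoop_eq (Progressive.dite h) hx hfix i i.isLt
  simpa using this

theorem iterate {f : α → α} (h : Progressive P Φ f) (k : ℕ) : Progressive P Φ f^[k] := by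
  rw [← forLoop_const]
  exact Progressive.forLoop (fun _ => h) k

/-- If `Φ` is at most `b`, then a fixed point is reached in `b` rounds. -/
theorem iterate_fixed {f : α → α} (h : Progressive P Φ f) {b : ℕ} (hb : ∀ x, P x → Φ x ≤ b)
    {x : α} (hx : P x) : f (f^[b] x) = f^[b] x := by
  have key : ∀ k, f (f^[k] x) = f^[k] x ∨ k < Φ (f (f^[k] x)) := by
    intro k
    induction k with
    | zero =>
      rcases (h x hx).2 with h | h
      · exact Or.inl h
      · exact Or.inr (by simp only [Function.iterate_zero, id]; omega)
    | succ k ih =>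
      rw [Function.iterate_succ_apply']
      rcases ih with ih | ih
      · left; rw [ih, ih]
      · have hk := (h.iterate k x hx).1
        rcases (h _ (h _ hk).1).2 with h' | h'
        · exact Or.inl h'
        · exact Or.inr (by omega)
  rcases key b with hk | hk
  · exact hk
  · have := hb _ (h _ (h.iterate b x hx).1).1
    omega

end Progressive

/-! ### Deferred acceptance by sweeps of single rejections -/

namespace DeferredAcceptance

variable {n : ℕ} (men : Man n → PrefList n) (women : Woman n → PrefList n)

/-- All pairs of men are tried once. -/
noncomputable def rejectSweep : (Man n → ℕ) → Man n → ℕ :=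
  finLoop fun m => finLoop fun m' => reject men women m m'

theorem progressive_reject (m m' : Man n) :
    Progressive (Reachable men women) (fun rej => ∑ m, rej m) (reject men women m m') := by
  classical
  refine fun rej h => ⟨h.reject m m', ?_⟩
  unfold reject
  split_ifs with hw
  · right
    apply Finset.sum_lt_sum
    · intro i _
      by_cases hi : i = m
      · subst hi; simp
      · rw [Function.update_of_ne hi]
    · exact ⟨m, Finset.mem_univ _, by simp⟩
  · exact Or.inl rfl

theorem progressive_rejectSweep :
    Progressive (Reachable men women) (fun rej => ∑ m, rej m) (rejectSweep men women) :=
  Progressive.finLoop fun m => Progressive.finLoop fun m' => progressive_reject men women m m'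

theorem iterate_rejectSweep :
    (rejectSweep men women)^[n * n] (fun _ => 0) = final men women := by
  have hP := progressive_rejectSweep men women
  have hb : ∀ rej, Reachable men women rej → ∑ m, rej m ≤ n * n := by
    intro rej h
    calc ∑ m, rej m ≤ ∑ _m : Man n, n := Finset.sum_le_sum fun m _ => (h.lt m).le
      _ = n * n := by simp
  have hfix := hP.iterate_fixed hb (reachable_zero men women)
  have hR := (hP.iterate (n * n) _ (reachable_zero men women)).1
  refine hR.eq_final fun m m' => ?_
  have h1 := Progressive.eq_of_finLoop_eq
    (fun m => Progressive.finLoop fun m' => progressive_reject men women m m') hR hfix m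
  exact Progressive.eq_of_finLoop_eq (fun m' => progressive_reject men women m m') hR h1 m'

end DeferredAcceptance

/-! ### Moving a woman to the front of a list -/

/-- The list in which the agent in position `k` is moved to the front. -/
def PrefList.toFront {n : ℕ} (l : PrefList n) (k : Fin n) : PrefList n :=
  (Fin.cycleRange k).symm.trans l

theorem PrefList.toFront_symm_apply {n : ℕ} (l : PrefList n) (k a : Fin n) :
    ((l.toFront k).symm a : ℕ) = if (l.symm a : ℕ) < k then (l.symm a : ℕ) + 1 else
      if (l.symm a : ℕ) = k then 0 else (l.symm a : ℕ) := by
  have : (l.toFront k).symm a = Fin.cycleRange k (l.symm a) := rfl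
  rw [this]
  split_ifs with h1 h2
  · exact Fin.coe_cycleRange_of_lt h1
  · rw [Fin.coe_cycleRange_of_le (Fin.le_def.2 h2.le), if_pos (Fin.ext h2)]
  · rw [Fin.cycleRange_of_gt (Fin.lt_def.2 (by omega))]

theorem PrefList.toFront_apply {n : ℕ} (l : PrefList n) (k j : Fin n) :
    l.toFront k j = if j.val = 0 then l k else
      if _h : j ≤ k then l ⟨j - 1, by omega⟩ else l j := by
  rw [← Equiv.eq_symm_apply, Fin.ext_iff, PrefList.toFront_symm_apply]
  have hle := @Fin.le_def n j k
  by_cases h1 : j.val = 0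
  · simp [h1]
  by_cases h2 : j ≤ k
  · simp only [h1, h2, if_false, dif_pos, Equiv.symm_apply_apply]
    split_ifs <;> omega
  · simp only [h1, h2, if_false, dif_neg, not_false_eq_true, Equiv.symm_apply_apply]
    split_ifs <;> omega

/-! ### The dynamics of moves to the front and its fixed points -/

namespace OneForManyGame

open DeferredAcceptance

variable {n : ℕ} (G : OneForManyGame n)

/-- The number of women above the partner of `m` in the list that he reports. -/
noncomputable def rejections (p : Man n → PrefList n) (m : Man n) : ℕ := final p G.womenPref m

/-- The profile in which `m` moves the woman in position `k` to the front. -/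
def moveToFront (m : Man n) (k : Fin n) (p : Man n → PrefList n) : Man n → PrefList n :=
  Function.update p m ((p m).toFront k)

open Classical in
/-- A strategic man `m` moves the woman in position `k` to the front if she is below his partner
and his partner remains the same. -/
noncomputable def attempt (m : Man n) (k : Fin n) (p : Man n → PrefList n) : Man n → PrefList n :=
  if m ∈ G.strategic ∧ 0 < G.rejections (moveToFront m k p) m ∧
    G.rejections (moveToFront m k p) m ≤ k then moveToFront m k p else p

/-- Reported lists deviate from the truth above the partners only. -/
def TruthfulBelow (p : Man n → PrefList n) : Prop :=
  G.IsStrategyProfile p ∧ ∀ m a b, (G.menPref m).Prefers b a → (p m).Prefers a b →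
    (p m).Prefers a (G.outcome p m)

theorem symm_outcome_apply (p : Man n → PrefList n) (m : Man n) :
    ((p m).symm (G.outcome p m) : ℕ) = G.rejections p m := symm_DA_apply p G.womenPref m

theorem not_prefers_outcome_update (p : Man n → PrefList n) (m : Man n) (l : PrefList n) :
    ¬ (p m).Prefers (G.outcome (Function.update p m l) m) (G.outcome p m) :=
  not_prefers_DA_update p G.womenPref m l

theorem moveToFront_self (m : Man n) (k : Fin n) (p : Man n → PrefList n) :
    moveToFront m k p m = (p m).toFront k := Function.update_self ..

theorem moveToFront_of_ne {m c : Man n} (h : c ≠ m) (k : Fin n) (p : Man n → PrefList n) :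
    moveToFront m k p c = p c := Function.update_of_ne h ..

/-- Strategyproofness is used in both directions, between `p` and the moved profile. Raising a woman
from below the partner thus yields either that woman (no rejections) or the old partner, now one
position lower. The first part makes the test `≤ k` in `attempt` exclude women already above the
partner, so that one run of deferred acceptance, at the moved profile, decides the attempt. -/
theorem rejections_moveToFront (m : Man n) (k : Fin n) (p : Man n → PrefList n) :
    (k < G.rejections p m → k < G.rejections (moveToFront m k p) m) ∧
    (G.rejections p m ≤ k → 0 < G.rejections (moveToFront m k p) m →
      G.rejections p m < k ∧ G.rejections (moveToFront m k p) m = G.rejections p m + 1 ∧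
      G.outcome (moveToFront m k p) m = G.outcome p m) := by
  have h1 := G.not_prefers_outcome_update p m ((p m).toFront k)
  have h2 := G.not_prefers_outcome_update (moveToFront m k p) m (p m)
  have h3 : Function.update (moveToFront m k p) m (p m) = p := by simp [moveToFront]
  rw [h3] at h2
  have h4 := G.symm_outcome_apply p m
  have h5 := G.symm_outcome_apply (moveToFront m k p) m
  change ¬ (p m).Prefers (G.outcome (moveToFront m k p) m) _ at h1
  rw [moveToFront_self, PrefList.toFront_symm_apply] at h5
  simp only [PrefList.Prefers, moveToFront_self, Fin.lt_def, PrefList.toFront_symm_apply]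
    at h1 h2 h5
  rw [h4] at h1 h2
  have h6 : ((p m).symm (G.outcome (moveToFront m k p) m) : ℕ) = G.rejections p m →
      G.outcome (moveToFront m k p) m = G.outcome p m := fun h =>
    (p m).symm.injective (Fin.ext (h.trans h4.symm))
  generalize hq : ((p m).symm (G.outcome (moveToFront m k p) m) : ℕ) = q at *
  constructor
  · intro h
    split_ifs at h1 h2 h5 <;> omega
  · intro h h'
    have : q = G.rejections p m := by split_ifs at h1 h2 h5 <;> omega
    refine ⟨?_, ?_, h6 this⟩ <;> split_ifs at h1 h2 h5 <;> omega

variable {G} in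
/-- The profile after a move that leaves the partner of the man unchanged. -/
theorem isStable_outcome_moveToFront {m : Man n} {k : Fin n} {p : Man n → PrefList n}
    (hk : G.rejections p m < k) (ho : G.outcome (moveToFront m k p) m = G.outcome p m) :
    IsStable p G.womenPref (G.outcome (moveToFront m k p)) := by
  intro c y hb
  -- The move only enlarges the set of women above the partner of `m`, so a blocking pair for `p`
  -- also blocks for the moved profile.
  refine isStable_DA (moveToFront m k p) G.womenPref c y ⟨?_, hb.2⟩
  by_cases hc : c = m
  swap
  · rw [moveToFront_of_ne hc]; exact hb.1
  subst hc
  change (moveToFront c k p c).Prefers y (G.outcome _ c)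
  have h1 := hb.1
  rw [ho, PrefList.Prefers, Fin.lt_def, symm_outcome_apply] at h1
  rw [moveToFront_self, ho, PrefList.Prefers, Fin.lt_def, PrefList.toFront_symm_apply,
    PrefList.toFront_symm_apply, symm_outcome_apply, if_pos hk]
  split_ifs <;> omega

variable {G} in
-- The new outcome is stable for `p`, where deferred acceptance is optimal for the men.
theorem rejections_le_moveToFront {m : Man n} {k : Fin n} {p : Man n → PrefList n}
    (hk : G.rejections p m < k) (ho : G.outcome (moveToFront m k p) m = G.outcome p m)
    {c : Man n} (hc : c ≠ m) : G.rejections p c ≤ G.rejections (moveToFront m k p) c := by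
  have h := not_lt.mp (not_prefers_of_isStable (isStable_outcome_moveToFront hk ho) c)
  have h1 := Fin.le_def.1 h
  have h2 := G.symm_outcome_apply (moveToFront m k p) c
  rw [moveToFront_of_ne hc] at h2
  rw [← symm_outcome_apply, ← h2]
  exact h1

/-- The only inversions created have the raised woman on top, and she is above the partner. Other
men keep their lists and descend, so what was above their partners stays above. -/
theorem progressive_attempt (m : Man n) (k : Fin n) :
    Progressive G.TruthfulBelow (fun p => ∑ m, G.rejections p m) (G.attempt m k) := by
  intro p hp
  unfold attempt
  split_ifs with h
  swap
  · exact ⟨hp, Or.inl rfl⟩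
  obtain ⟨hm, h0, hle⟩ := h
  have hr := G.rejections_moveToFront m k p
  obtain ⟨hk, h1, ho⟩ := hr.2 (not_lt.mp fun h => absurd (hr.1 h) (by omega)) h0
  have hmono := fun c (hc : c ≠ m) => rejections_le_moveToFront hk ho hc
  refine ⟨⟨?_, ?_⟩, Or.inr ?_⟩
  · intro c hc
    rw [moveToFront_of_ne (ne_of_mem_of_not_mem hm hc).symm]
    exact hp.1 c hc
  · intro c a b hab hba
    by_cases hc : c = m
    · subst hc
      have hinv := hp.2 c a b hab
      rw [moveToFront_self] at hba ⊢
      rw [PrefList.Prefers, Fin.lt_def, PrefList.toFront_symm_apply,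
        PrefList.toFront_symm_apply] at hba
      rw [ho, PrefList.Prefers, Fin.lt_def, PrefList.toFront_symm_apply,
        PrefList.toFront_symm_apply, symm_outcome_apply, if_pos hk]
      rw [PrefList.Prefers, PrefList.Prefers, Fin.lt_def, Fin.lt_def, symm_outcome_apply] at hinv
      split_ifs at hba ⊢ <;> omega
    · rw [moveToFront_of_ne hc] at hba
      have h2 := hp.2 c a b hab hba
      have h3 := G.symm_outcome_apply (moveToFront m k p) c
      rw [PrefList.Prefers, Fin.lt_def] at h2 ⊢
      rw [symm_outcome_apply] at h2
      rw [h3, moveToFront_of_ne hc]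
      exact lt_of_lt_of_le h2 (hmono c hc)
  · apply Finset.sum_lt_sum
    · intro c _
      by_cases hc : c = m
      · subst hc; omega
      · exact hmono c hc
    · exact ⟨m, Finset.mem_univ _, by omega⟩

theorem truthfulBelow_menPref : G.TruthfulBelow G.menPref :=
  ⟨fun _ _ => rfl, fun _ _ _ h h' => absurd h (lt_asymm h')⟩

variable {G} in
-- If `w` were reported below the partner, the partner would be the upper member of an inversion and
-- hence reported above himself or herself, which is absurd.
theorem TruthfulBelow.prefers {p : Man n → PrefList n} (hp : G.TruthfulBelow p) {m : Man n}
    {w : Woman n} (h : (G.menPref m).Prefers w (G.outcome p m)) :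
    (p m).Prefers w (G.outcome p m) := by
  by_contra hn
  refine lt_irrefl _ (hp.2 m _ w h (lt_of_le_of_ne (not_lt.mp hn) fun he => ?_))
  rw [(p m).symm.injective he] at h
  exact lt_irrefl _ h

variable {G} in
theorem TruthfulBelow.isStable {p : Man n → PrefList n} (hp : G.TruthfulBelow p) :
    IsStable G.menPref G.womenPref (G.outcome p) := fun m w hb =>
  isStable_DA p G.womenPref m w ⟨hp.prefers hb.1, hb.2⟩

variable {G} in
/-- A profile at which no attempt succeeds is a Nash equilibrium. -/
theorem TruthfulBelow.isNashEquilibrium {p : Man n → PrefList n} (hp : G.TruthfulBelow p)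
    (hfix : ∀ m k, G.attempt m k p = p) : G.IsNashEquilibrium p := by
  refine ⟨hp.1, fun m hm l hl => ?_⟩
  obtain ⟨-, ⟨w, -, hw⟩, hreg⟩ := hl
  -- A truly better partner would also be better according to `p m`, against strategyproofness at
  -- `p`.
  have hpartner : G.outcome (Function.update p m l) m = G.outcome p m := by
    by_contra hne
    refine G.not_prefers_outcome_update p m l (hp.prefers (lt_of_le_of_ne hreg fun he => hne ?_))
    exact (G.menPref m).symm.injective he
  have hst : IsStable (Function.update p m l) G.womenPref (G.outcome p) := by
    intro c y hb
    by_cases hc : c = m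
    swap
    · refine isStable_DA p G.womenPref c y ⟨?_, hb.2⟩
      have := hb.1
      rwa [Function.update_of_ne hc] at this
    subst hc
    by_cases hy : (p c).Prefers y (G.outcome p c)
    · exact isStable_DA p G.womenPref c y ⟨hy, hb.2⟩
    have hb1 := hb.1
    rw [Function.update_self] at hb1
    set k := (p c).symm y with hk
    have hlt : G.rejections p c < k := by
      refine lt_of_le_of_ne ?_ fun he => ?_
      · rw [← symm_outcome_apply]; exact not_lt.mp hy
      · rw [← symm_outcome_apply] at he
        rw [(p c).symm.injective (Fin.ext he)] at hb1
        exact lt_irrefl _ hb1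
    have hr := G.rejections_moveToFront c k p
    -- Otherwise the move would keep the partner, the attempt would succeed and `p` would change.
    have hzero : G.rejections (moveToFront c k p) c = 0 := by
      by_contra hne
      obtain ⟨-, h1, -⟩ := hr.2 hlt.le (Nat.pos_of_ne_zero hne)
      have hf := hfix c k
      unfold attempt at hf
      rw [if_pos ⟨hm, Nat.pos_of_ne_zero hne, by omega⟩] at hf
      rw [hf] at h1
      omega
    have hout : G.outcome (moveToFront c k p) c = y := by
      have h1 := G.symm_outcome_apply (moveToFront c k p) c
      rw [hzero] at h1
      refine (moveToFront c k p c).symm.injective (Fin.ext (h1.trans ?_))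
      rw [moveToFront_self, PrefList.toFront_symm_apply, if_neg (lt_irrefl _), if_pos rfl]
    -- Take `l` as the truth: reporting `y` first wins `y`, whom `l` ranks above the partner
    -- obtained by reporting `l`.
    have := G.not_prefers_outcome_update (Function.update p c l) c ((p c).toFront k)
    rw [Function.update_idem, Function.update_self, hpartner] at this
    change ¬ l.Prefers (G.outcome (moveToFront c k p) c) _ at this
    rw [hout] at this
    exact this hb1
  -- Deferred acceptance at the new profile is worst for every woman among its stable matchings, one
  -- of which is the old outcome.
  exact absurd hw (not_lt.mpr (weaklyPrefers_of_isStable hst w))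

/-- All attempts are made once. -/
noncomputable def attemptSweep : (Man n → PrefList n) → Man n → PrefList n :=
  finLoop fun m => finLoop fun k => G.attempt m k

theorem progressive_attemptSweep :
    Progressive G.TruthfulBelow (fun p => ∑ m, G.rejections p m) G.attemptSweep :=
  Progressive.finLoop fun m => Progressive.finLoop fun k => G.progressive_attempt m k

/-- The equilibrium that is computed by the algorithm. -/
noncomputable def equilibrium : Man n → PrefList n := G.attemptSweep^[n * n] G.menPref

theorem truthfulBelow_equilibrium : G.TruthfulBelow G.equilibrium :=
  (G.progressive_attemptSweep.iterate (n * n) _ G.truthfulBelow_menPref).1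

theorem isNashEquilibrium_equilibrium : G.IsNashEquilibrium G.equilibrium := by
  have hb : ∀ p, G.TruthfulBelow p → ∑ m, G.rejections p m ≤ n * n := by
    intro p _
    calc ∑ m, G.rejections p m ≤ ∑ _m : Man n, n :=
          Finset.sum_le_sum fun m _ => (final_lt p G.womenPref m).le
      _ = n * n := by simp
  have hfix := G.progressive_attemptSweep.iterate_fixed hb G.truthfulBelow_menPref
  have hE := G.truthfulBelow_equilibrium
  refine hE.isNashEquilibrium fun m k => ?_
  have h1 := Progressive.eq_of_finLoop_eq
    (fun m => Progressive.finLoop fun k => G.progressive_attempt m k) hE hfix m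
  exact Progressive.eq_of_finLoop_eq (fun k => G.progressive_attempt m k) hE h1 k

end OneForManyGame

/-! ### A structured language with polynomially bounded running time -/

namespace RAM

/-- Expressions. The variables of the enclosing binders are counted from the innermost one, and
`size` is the problem size `n`. -/
inductive Expr : Type
  | const (c : ℕ)
  | size
  | var (i : ℕ)
  | add (a b : Expr)
  | mulSize (a : Expr)
  | load (a : Expr)

/-- The value of an expression. -/
def Expr.eval (n : ℕ) (env : List ℕ) (mem : ℕ → ℕ) : Expr → ℕ
  | const c => c
  | size => n
  | var i => env.getD i n
  | add a b => a.eval n env mem + b.eval n env mem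
  | mulSize a => n * a.eval n env mem
  | load a => mem (a.eval n env mem)

/-- Statements. All loops have `n` rounds. `letE` and `loop` bind a variable. -/
inductive Stmt : Type
  | skip
  | store (a b : Expr)
  | seq (c d : Stmt)
  | ite (a b : Expr) (c d : Stmt)
  | letE (a : Expr) (c : Stmt)
  | loop (c : Stmt)

/-- The memory after the execution of a statement. -/
def Stmt.run (n : ℕ) : Stmt → List ℕ → (ℕ → ℕ) → (ℕ → ℕ)
  | skip, _, mem => mem
  | store a b, env, mem => Function.update mem (a.eval n env mem) (b.eval n env mem)
  | seq c d, env, mem => d.run n env (c.run n env mem)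
  | ite a b c d, env, mem =>
      if a.eval n env mem < b.eval n env mem then c.run n env mem else d.run n env mem
  | letE a c, env, mem => c.run n (a.eval n env mem :: env) mem
  | loop c, env, mem => forLoop (fun i => c.run n (i :: env)) n mem

/-- Code that leaves the value of the expression in register `r + 1` and uses no registers up
to `r`. The size is in register `0`, the variables are in the registers `1` to `d`. -/
def Expr.compile (d : ℕ) : Expr → ℕ → Program
  | const c, r => .const (r + 1) c
  | size, r => .seq (.const (r + 1) 0) (.add (r + 1) 0 (r + 1))
  | var i, r => .seq (.const (r + 1) 0) (.add (r + 1) (d - i) (r + 1))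
  | add a b, r => .seq (a.compile d r) (.seq (b.compile d (r + 1)) (.add (r + 1) (r + 1) (r + 2)))
  | mulSize a, r => .seq (a.compile d (r + 2)) (.seq (.const (r + 1) 0) (.seq (.const (r + 2) 0)
      (.seq (.const (r + 4) 1)
        (.while (r + 2) 0
          (.seq (.add (r + 1) (r + 1) (r + 3)) (.add (r + 2) (r + 2) (r + 4)))))))
  | load a, r => .seq (a.compile d r) (.load (r + 1) (r + 1))

/-- Code for a statement in the scope of `d` variables. -/
def Stmt.compile : Stmt → ℕ → Program
  | skip, d => .const (d + 1) 0
  | store a b, d => .seq (a.compile d d) (.seq (b.compile d (d + 1)) (.store (d + 1) (d + 2)))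
  | seq c e, d => .seq (c.compile d) (e.compile d)
  | ite a b c e, d => .seq (a.compile d d) (.seq (b.compile d (d + 1))
      (.ite (d + 1) (d + 2) (c.compile d) (e.compile d)))
  | letE a c, d => .seq (a.compile d d) (c.compile (d + 1))
  | loop c, d => .seq (.const (d + 1) 0) (.while (d + 1) 0
      (.seq (c.compile (d + 1)) (.seq (.const (d + 2) 1) (.add (d + 1) (d + 1) (d + 2)))))

/-! ### Correctness and running time of compiled code -/

/-- The registers hold the size and the values of the variables. -/
def Matches (n : ℕ) (env : List ℕ) (s : State) : Prop :=
  ∀ i, s.reg (env.length - i) = env.getD i n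

theorem Matches.size {n : ℕ} {env : List ℕ} {s : State} (h : Matches n env s) : s.reg 0 = n := by
  -- An index beyond the scope has the default value `n`, and truncated subtraction sends it to
  -- register `0`, which holds the size.
  have := h env.length
  rwa [Nat.sub_self, List.getD_eq_default _ _ le_rfl] at this

theorem Matches.congr {n : ℕ} {env : List ℕ} {s u : State} (h : Matches n env s)
    (hu : ∀ r ≤ env.length, u.reg r = s.reg r) : Matches n env u := fun i => by
  rw [hu _ (Nat.sub_le _ _), h i]

theorem Matches.cons {n v : ℕ} {env : List ℕ} {s u : State} (h : Matches n env s)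
    (hu : ∀ r ≤ env.length, u.reg r = s.reg r) (hv : u.reg (env.length + 1) = v) :
    Matches n (v :: env) u := by
  intro i
  cases i with
  | zero => simpa using hv
  | succ i =>
    rw [List.length_cons, Nat.add_sub_add_right, List.getD_cons_succ, hu _ (Nat.sub_le _ _), h i]

/-- The invariant includes the counter in `x` and its bound in `y`. Each round costs its body and
one test, and the last test fails. -/
theorem exec_while {x y n B : ℕ} {c : Program} (I : ℕ → State → Prop)
    (hI : ∀ i s, I i s → s.reg x = i ∧ s.reg y = n)
    (hc : ∀ i < n, ∀ s, I i s → ∃ t u, Exec c s t u ∧ t ≤ B ∧ I (i + 1) u)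
    (k i : ℕ) (hk : i + k = n) (s : State) (hs : I i s) :
    ∃ t u, Exec (.while x y c) s t u ∧ t ≤ k * (B + 1) + 1 ∧ I n u := by
  induction k generalizing i s with
  | zero =>
    obtain rfl : i = n := by omega
    have := hI _ _ hs
    exact ⟨1, s, .whileFalse (by omega), by omega, hs⟩
  | succ k ih =>
    have h := hI _ _ hs
    obtain ⟨t, u, he, ht, hu⟩ := hc i (by omega) s hs
    obtain ⟨t', v, he', ht', hv⟩ := ih (i + 1) (by omega) u hu
    refine ⟨t + t' + 1, v, .whileTrue (by omega) he he', ?_, hv⟩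
    rw [Nat.succ_mul]
    omega

theorem Expr.exec_compile (e : Expr) : ∃ q : Polynomial ℕ, ∀ (n r : ℕ) (env : List ℕ) (s : State),
    env.length ≤ r → Matches n env s → ∃ t u, Exec (e.compile env.length r) s t u ∧
      t ≤ q.eval n ∧ u.mem = s.mem ∧ u.reg (r + 1) = e.eval n env s.mem ∧
      ∀ i ≤ r, u.reg i = s.reg i := by
  induction e with
  | const c =>
    refine ⟨1, fun n r env s hr hs => ⟨_, _, .const .., by simp, rfl, ?_, fun i hi => ?_⟩⟩
    · simp [State.setReg, eval]
    · simp [State.setReg, show i ≠ r + 1 by omega]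
  | size =>
    refine ⟨2, fun n r env s hr hs => ⟨_, _, .seq (.const ..) (.add ..), by simp, rfl, ?_,
      fun i hi => ?_⟩⟩
    · simp [State.setReg, eval, hs.size]
    · simp [State.setReg, show i ≠ r + 1 by omega]
  | var j =>
    refine ⟨2, fun n r env s hr hs => ⟨_, _, .seq (.const ..) (.add ..), by simp, rfl, ?_,
      fun i hi => ?_⟩⟩
    · simp [State.setReg, eval, show env.length - j ≠ r + 1 by omega, hs j]
    · simp [State.setReg, show i ≠ r + 1 by omega]
  | add a b iha ihb =>
    obtain ⟨p, hp⟩ := iha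
    obtain ⟨q, hq⟩ := ihb
    refine ⟨p + (q + 1), fun n r env s hr hs => ?_⟩
    obtain ⟨t, u, h1, h2, h3, h4, h5⟩ := hp n r env s hr hs
    obtain ⟨t', u', h1', h2', h3', h4', h5'⟩ := hq n (r + 1) env u (by omega)
      (hs.congr fun i hi => h5 i (by omega))
    refine ⟨_, _, .seq h1 (.seq h1' (.add ..)), ?_, ?_, ?_, fun i hi => ?_⟩
    · simp only [Polynomial.eval_add, Polynomial.eval_one]; omega
    · simp [State.setReg, h3, h3']
    · simp [State.setReg, eval, h4', h5' (r + 1) le_rfl, h4, h3]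
    · simp [State.setReg, show i ≠ r + 1 by omega, h5' i (by omega), h5 i hi]
  | mulSize a iha =>
    obtain ⟨p, hp⟩ := iha
    refine ⟨p + (1 + (1 + (1 + (Polynomial.X * 3 + 1)))), fun n r env s hr hs => ?_⟩
    -- Multiplication by `n` is repeated addition: the factor is in `r + 3`, the sum in `r + 1`, the
    -- counter in `r + 2` and the increment `1` in `r + 4`.
    obtain ⟨t, u, h1, h2, h3, h4, h5⟩ := hp n (r + 2) env s (by omega) hs
    obtain ⟨t', v, h6, h7, h8⟩ := exec_while (x := r + 2) (y := 0) (n := n) (B := 2)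
      (c := .seq (.add (r + 1) (r + 1) (r + 3)) (.add (r + 2) (r + 2) (r + 4)))
      (fun i w => (w.reg (r + 2) = i ∧ w.reg 0 = n) ∧ w.reg (r + 1) = i * a.eval n env s.mem ∧
        w.reg (r + 3) = a.eval n env s.mem ∧ w.reg (r + 4) = 1 ∧ w.mem = s.mem ∧
        ∀ j ≤ r, w.reg j = s.reg j)
      (fun i w h => h.1) (fun i hi w ⟨⟨g1, g2⟩, g3, g4, g5, g6, g7⟩ => ⟨_, _, .seq (.add ..)
        (.add ..), le_rfl, ⟨by simp [State.setReg, g1, g5], by simp [State.setReg, g2]⟩,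
        by simp [State.setReg, g3, g4, Nat.succ_mul], by simp [State.setReg, g4],
        by simp [State.setReg, g5], by simp [State.setReg, g6], fun j hj => by
          simp [State.setReg, g7 j hj, show j ≠ r + 1 by omega, show j ≠ r + 2 by omega]⟩)
      n 0 (Nat.zero_add n) (((u.setReg (r + 1) 0).setReg (r + 2) 0).setReg (r + 4) 1)
      ⟨⟨by simp [State.setReg], by simp [State.setReg, h5, hs.size]⟩, by simp [State.setReg],
        by simp [State.setReg, h4], by simp [State.setReg], by simp [State.setReg, h3],
        fun j hj => by
          simp [State.setReg, h5 j (by omega), show j ≠ r + 1 by omega, show j ≠ r + 2 by omega,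
            show j ≠ r + 4 by omega]⟩
    refine ⟨_, v, .seq h1 (.seq (.const ..) (.seq (.const ..) (.seq (.const ..) h6))), ?_,
      h8.2.2.2.2.1, h8.2.1, h8.2.2.2.2.2⟩
    simp only [Polynomial.eval_add, Polynomial.eval_one, Polynomial.eval_mul, Polynomial.eval_X,
      Polynomial.eval_ofNat]
    omega
  | load a iha =>
    obtain ⟨p, hp⟩ := iha
    refine ⟨p + 1, fun n r env s hr hs => ?_⟩
    obtain ⟨t, u, h1, h2, h3, h4, h5⟩ := hp n r env s hr hs
    refine ⟨_, _, .seq h1 (.load ..), ?_, ?_, ?_, fun i hi => ?_⟩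
    · simp only [Polynomial.eval_add, Polynomial.eval_one]; omega
    · simp [State.setReg, h3]
    · simp [State.setReg, eval, h4, h3]
    · simp [State.setReg, show i ≠ r + 1 by omega, h5 i hi]

theorem Stmt.exec_compile (c : Stmt) : ∃ q : Polynomial ℕ, ∀ (n : ℕ) (env : List ℕ) (s : State),
    Matches n env s → ∃ t u, Exec (c.compile env.length) s t u ∧
      t ≤ q.eval n ∧ u.mem = c.run n env s.mem ∧ ∀ i ≤ env.length, u.reg i = s.reg i := by
  induction c with
  | skip =>
    refine ⟨1, fun n env s hs => ⟨_, _, .const .., by simp, rfl, fun i hi => ?_⟩⟩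
    simp [State.setReg, show i ≠ env.length + 1 by omega]
  | store a b =>
    obtain ⟨p, hp⟩ := a.exec_compile
    obtain ⟨q, hq⟩ := b.exec_compile
    refine ⟨p + (q + 1), fun n env s hs => ?_⟩
    obtain ⟨t, u, h1, h2, h3, h4, h5⟩ := hp n _ env s le_rfl hs
    obtain ⟨t', u', h1', h2', h3', h4', h5'⟩ := hq n (env.length + 1) env u (by omega)
      (hs.congr h5)
    refine ⟨_, _, .seq h1 (.seq h1' (.store ..)), ?_, ?_, fun i hi => ?_⟩
    · simp only [Polynomial.eval_add, Polynomial.eval_one]; omega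
    · simp [State.setMem, run, h4', h5' _ le_rfl, h4, h3, h3']
    · simp [State.setMem, h5' i (by omega), h5 i hi]
  | seq c d ihc ihd =>
    obtain ⟨p, hp⟩ := ihc
    obtain ⟨q, hq⟩ := ihd
    refine ⟨p + q, fun n env s hs => ?_⟩
    obtain ⟨t, u, h1, h2, h3, h4⟩ := hp n env s hs
    obtain ⟨t', v, h1', h2', h3', h4'⟩ := hq n env u (hs.congr h4)
    refine ⟨_, v, .seq h1 h1', ?_, ?_, fun i hi => by rw [h4' i hi, h4 i hi]⟩
    · rw [Polynomial.eval_add]; omega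
    · rw [h3', h3, run]
  | ite a b c d ihc ihd =>
    obtain ⟨pa, ha⟩ := a.exec_compile
    obtain ⟨pb, hb⟩ := b.exec_compile
    obtain ⟨p, hp⟩ := ihc
    obtain ⟨q, hq⟩ := ihd
    refine ⟨pa + (pb + (p + q + 1)), fun n env s hs => ?_⟩
    obtain ⟨t, u, h1, h2, h3, h4, h5⟩ := ha n _ env s le_rfl hs
    obtain ⟨t', u', h1', h2', h3', h4', h5'⟩ := hb n (env.length + 1) env u (by omega)
      (hs.congr h5)
    have hx : u'.reg (env.length + 1) = a.eval n env s.mem := by rw [h5' _ le_rfl, h4]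
    have hy : u'.reg (env.length + 2) = b.eval n env s.mem := by rw [h4', h3]
    have hm : Matches n env u' := hs.congr fun i hi => by rw [h5' i (by omega), h5 i hi]
    simp only [Polynomial.eval_add, Polynomial.eval_one]
    by_cases hlt : a.eval n env s.mem < b.eval n env s.mem
    · obtain ⟨t'', v, g1, g2, g3, g4⟩ := hp n env u' hm
      refine ⟨_, v, .seq h1 (.seq h1' (.iteTrue (by rwa [hx, hy]) g1)), by omega, ?_,
        fun i hi => by rw [g4 i hi, h5' i (by omega), h5 i hi]⟩
      rw [g3, h3', h3, run, if_pos hlt]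
    · obtain ⟨t'', v, g1, g2, g3, g4⟩ := hq n env u' hm
      refine ⟨_, v, .seq h1 (.seq h1' (.iteFalse (by rwa [hx, hy]) g1)), by omega, ?_,
        fun i hi => by rw [g4 i hi, h5' i (by omega), h5 i hi]⟩
      rw [g3, h3', h3, run, if_neg hlt]
  | letE a c ihc =>
    obtain ⟨p, hp⟩ := a.exec_compile
    obtain ⟨q, hq⟩ := ihc
    refine ⟨p + q, fun n env s hs => ?_⟩
    obtain ⟨t, u, h1, h2, h3, h4, h5⟩ := hp n _ env s le_rfl hs
    obtain ⟨t', v, h1', h2', h3', h4'⟩ := hq n _ u (hs.cons h5 h4)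
    refine ⟨_, v, .seq h1 h1', ?_, ?_, fun i hi => ?_⟩
    · rw [Polynomial.eval_add]; omega
    · rw [h3', h3, run]
    · rw [h4' i (by rw [List.length_cons]; omega), h5 i hi]
  | loop c ihc =>
    obtain ⟨q, hq⟩ := ihc
    -- Each of the `n` rounds costs the body, two steps for the increment and one test.
    refine ⟨1 + (Polynomial.X * (q + 3) + 1), fun n env s hs => ?_⟩
    obtain ⟨t', v, h6, h7, h8⟩ := exec_while (x := env.length + 1) (y := 0) (n := n)
      (B := q.eval n + 2)
      (c := .seq (c.compile (env.length + 1))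
        (.seq (.const (env.length + 2) 1) (.add (env.length + 1) (env.length + 1) (env.length + 2))))
      (fun i w => (w.reg (env.length + 1) = i ∧ w.reg 0 = n) ∧
        w.mem = forLoop (fun i => c.run n (i :: env)) i s.mem ∧
        ∀ j ≤ env.length, w.reg j = s.reg j)
      (fun i w h => h.1) (fun i hi w ⟨⟨g1, g2⟩, g3, g4⟩ => by
        obtain ⟨t, u, h1, h2, h3, h4⟩ := hq n _ w (hs.cons g4 g1)
        rw [List.length_cons] at h1 h4
        refine ⟨_, _, .seq h1 (.seq (.const ..) (.add ..)), by omega, ⟨?_, ?_⟩, ?_, fun j hj => ?_⟩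
        · simp [State.setReg, h4 _ le_rfl, g1]
        · simp [State.setReg, h4, g2]
        · simp only [State.setReg, h3, g3, forLoop]
        · simp [State.setReg, show j ≠ env.length + 1 by omega, show j ≠ env.length + 2 by omega,
            h4 j (by omega), g4 j hj])
      n 0 (Nat.zero_add n) (s.setReg (env.length + 1) 0)
      ⟨⟨by simp [State.setReg], by simp [State.setReg, hs.size]⟩, rfl, fun j hj => by
          simp [State.setReg, show j ≠ env.length + 1 by omega]⟩
    refine ⟨_, v, .seq (.const ..) h6, ?_, h8.2.1, h8.2.2⟩
    simp only [Polynomial.eval_add, Polynomial.eval_one, Polynomial.eval_mul, Polynomial.eval_X,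
      Polynomial.eval_ofNat]
    rw [show Polynomial.eval n q + 3 = Polynomial.eval n q + 2 + 1 from rfl]
    omega

/-- Statements are executed in polynomial time. The size is the first cell of the input. -/
theorem Stmt.exists_program (c : Stmt) : ∃ (d : Program) (q : Polynomial ℕ),
    ∀ (n : ℕ) (input : List ℕ), ∃ t u, Exec d (initial (n :: input)) t u ∧ t ≤ q.eval n ∧
      u.mem = c.run n [] (initial (n :: input)).mem := by
  obtain ⟨q, hq⟩ := c.exec_compile
  -- Register `0` is initially `0`, so this loads the first memory cell, the size, into register
  -- `0`.
  refine ⟨.seq (.load 0 0) (c.compile 0), 1 + q, fun n input => ?_⟩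
  obtain ⟨t, u, h1, h2, h3, -⟩ := hq n [] ((initial (n :: input)).setReg 0 n)
    (fun i => by simp [State.setReg])
  refine ⟨_, u, .seq (.load ..) h1, ?_, h3⟩
  rw [Polynomial.eval_add, Polynomial.eval_one]
  omega

end RAM

/-! ### Tables in the memory -/

namespace RAM

/-- The matrix `f` is stored row by row from the address `base` on. -/
def HoldsTable {n : ℕ} (base : ℕ) (f : Fin n → Fin n → ℕ) (mem : ℕ → ℕ) : Prop :=
  ∀ i j : Fin n, mem (base + (n * i + j)) = f i j

/-- The vector `f` is stored from the address `base` on. -/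
def HoldsVec {n : ℕ} (base : ℕ) (f : Fin n → ℕ) (mem : ℕ → ℕ) : Prop :=
  ∀ i : Fin n, mem (base + i) = f i

/-- Two memories agree except for the `len` cells from the address `base` on. -/
def EqOutside (base len : ℕ) (mem mem' : ℕ → ℕ) : Prop :=
  ∀ a, a < base ∨ base + len ≤ a → mem' a = mem a

theorem index_lt {n i j : ℕ} (hi : i < n) (hj : j < n) : n * i + j < n * n := by
  calc n * i + j < n * i + n := by omega
    _ = n * (i + 1) := by ring
    _ ≤ n * n := Nat.mul_le_mul_left n hi

theorem index_inj {n i j i' j' : ℕ} (hj : j < n) (hj' : j' < n) (h : n * i + j = n * i' + j') :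
    i = i' ∧ j = j' := by
  have h1 : (n * i + j) / n = (n * i' + j') / n := by rw [h]
  have h2 : (n * i + j) % n = (n * i' + j') % n := by rw [h]
  rw [Nat.mul_add_div (by omega), Nat.mul_add_div (by omega), Nat.div_eq_of_lt hj,
    Nat.div_eq_of_lt hj'] at h1
  rw [Nat.mul_add_mod, Nat.mul_add_mod, Nat.mod_eq_of_lt hj, Nat.mod_eq_of_lt hj'] at h2
  exact ⟨h1, h2⟩

theorem EqOutside.refl (base len : ℕ) (mem : ℕ → ℕ) : EqOutside base len mem mem :=
  fun _ _ => rfl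

theorem EqOutside.trans {base len : ℕ} {mem mem' mem'' : ℕ → ℕ}
    (h : EqOutside base len mem mem') (h' : EqOutside base len mem' mem'') :
    EqOutside base len mem mem'' := fun a ha => (h' a ha).trans (h a ha)

theorem EqOutside.update {base len : ℕ} (mem : ℕ → ℕ) {a : ℕ} (v : ℕ)
    (h : base ≤ a ∧ a < base + len) : EqOutside base len mem (Function.update mem a v) :=
  fun b hb => Function.update_of_ne (by omega) ..

theorem HoldsTable.congr {n base base' len : ℕ} {f : Fin n → Fin n → ℕ} {mem mem' : ℕ → ℕ}
    (h : HoldsTable base f mem) (he : EqOutside base' len mem mem')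
    (hd : base + n * n ≤ base' ∨ base' + len ≤ base) : HoldsTable base f mem' := fun i j => by
  have := index_lt i.isLt j.isLt
  rw [he _ (by omega), h i j]

theorem HoldsVec.congr {n base base' len : ℕ} {f : Fin n → ℕ} {mem mem' : ℕ → ℕ}
    (h : HoldsVec base f mem) (he : EqOutside base' len mem mem')
    (hd : base + n ≤ base' ∨ base' + len ≤ base) : HoldsVec base f mem' := fun i => by
  have := i.isLt
  rw [he _ (by omega), h i]

/-- A nested loop fills a table. In row `i`, the columns are visited in the order `σ i`. -/
theorem forLoop_table {n D : ℕ} (σ : Fin n → Equiv.Perm (Fin n)) (v : Fin n → Fin n → ℕ)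
    {body : ℕ → ℕ → (ℕ → ℕ) → ℕ → ℕ} {mem : ℕ → ℕ}
    (h : ∀ (i j : Fin n) (mem' : ℕ → ℕ), EqOutside D (n * n) mem mem' →
      body i j mem' = Function.update mem' (D + (n * i + σ i j)) (v i j)) :
    HoldsTable D (fun i j => v i ((σ i).symm j)) (forLoop (fun i => forLoop (body i) n) n mem) ∧
      EqOutside D (n * n) mem (forLoop (fun i => forLoop (body i) n) n mem) := by
  have key := forLoop_induction (f := fun i => forLoop (body i) n) (k := n) (x := mem)
    (fun k mem' => EqOutside D (n * n) mem mem' ∧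
      ∀ i j : Fin n, (i : ℕ) < k → mem' (D + (n * i + σ i j)) = v i j)
    ⟨EqOutside.refl _ _ _, fun i j hi => absurd hi (Nat.not_lt_zero _)⟩ ?_
  · refine ⟨fun i j => ?_, key.1⟩
    have := key.2 i ((σ i).symm j) i.isLt
    rwa [Equiv.apply_symm_apply] at this
  intro k hk mem' ⟨h1, h2⟩
  have inner := forLoop_induction (f := body k) (k := n) (x := mem')
    (fun l mem'' => EqOutside D (n * n) mem mem'' ∧
      ∀ i j : Fin n, (i : ℕ) < k ∨ (i : ℕ) = k ∧ (j : ℕ) < l →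
        mem'' (D + (n * i + σ i j)) = v i j)
    ⟨h1, fun i j hi => h2 i j (by omega)⟩ ?_
  · exact ⟨inner.1, fun i j hi => inner.2 i j (by omega)⟩
  intro l hl mem'' ⟨h3, h4⟩
  have hb := h ⟨k, hk⟩ ⟨l, hl⟩ mem'' h3
  simp only at hb
  rw [hb]
  have hlt := index_lt hk (σ ⟨k, hk⟩ ⟨l, hl⟩).isLt
  refine ⟨h3.trans (EqOutside.update _ _ (by omega)), fun i j hij => ?_⟩
  by_cases heq : i = ⟨k, hk⟩ ∧ j = ⟨l, hl⟩
  · obtain ⟨rfl, rfl⟩ := heq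
    rw [Function.update_self]
  · rw [Function.update_of_ne]
    · refine h4 i j ?_
      simp only [Fin.ext_iff] at heq
      omega
    · intro hne
      obtain ⟨g1, g2⟩ := index_inj (σ i j).isLt (σ ⟨k, hk⟩ ⟨l, hl⟩).isLt
        (Nat.add_left_cancel hne)
      obtain rfl : i = ⟨k, hk⟩ := Fin.ext g1
      exact heq ⟨rfl, (σ _).injective (Fin.ext g2)⟩

/-! ### The program -/

namespace Expr

/-- The address of an entry of a table. -/
def cell (base i j : Expr) : Expr := .add base (.add (.mulSize i) j)

/-- The current lists of the men are stored from here on. -/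
def lists : Expr := .const 1

/-- The lists of the women, and later the tentative lists of the men. -/
def tentative : Expr := .add (.const 1) (.mulSize .size)

/-- The indicator vector of the strategic men. -/
def strategic : Expr := .add tentative (.mulSize .size)

/-- The positions of the men in the lists of the women. -/
def ranks : Expr := .add strategic .size

/-- The numbers of rejections in the deferred acceptance algorithm. -/
def rejections : Expr := .add ranks (.mulSize .size)

end Expr

namespace Stmt

open RAM.Expr

/-- Copy a table. -/
def copy (dst src : Expr) : Stmt :=
  .loop (.loop (.store (cell dst (.var 1) (.var 0)) (.load (cell src (.var 1) (.var 0)))))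

/-- Compute the ranks from the lists of the women. -/
def computeRanks : Stmt :=
  .loop (.loop (.store (cell ranks (.var 1) (.load (cell tentative (.var 1) (.var 0)))) (.var 0)))

/-- The men with the numbers `var 1` and `var 0` are compared, and the former is rejected if he
is a less preferred suitor of the same woman. -/
def rejectOne : Stmt :=
  .letE (.load (cell tentative (.var 1) (.load (.add rejections (.var 1)))))
    (.letE (.load (cell tentative (.var 1) (.load (.add rejections (.var 1)))))
      (.ite (.var 0) (.var 1) .skip (.ite (.var 1) (.var 0) .skip
        (.ite (.load (cell ranks (.var 1) (.var 2))) (.load (cell ranks (.var 1) (.var 3)))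
          (.store (.add rejections (.var 3))
            (.add (.load (.add rejections (.var 3))) (.const 1))) .skip))))

/-- Deferred acceptance for the tentative lists. -/
def deferredAcceptance : Stmt :=
  .seq (.loop (.store (.add rejections (.var 0)) (.const 0)))
    (.loop (.loop (.loop (.loop rejectOne))))

/-- The tentative lists are the current ones, except that man `var 1` moves the woman in
position `var 0` to the front. -/
def copyMoved : Stmt :=
  let keep : Stmt := .store (cell tentative (.var 1) (.var 0)) (.load (cell lists (.var 1) (.var 0)))
  .loop (.loop (.ite (.var 1) (.var 3) keep (.ite (.var 3) (.var 1) keep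
    (.ite (.var 0) (.const 1)
      (.store (cell tentative (.var 1) (.var 0)) (.load (cell lists (.var 3) (.var 2))))
      (.ite (.var 2) (.var 0) keep
        (.store (cell tentative (.var 1) (.var 0)) (.load (cell (.const 0) (.var 1) (.var 0)))))))))

/-- The move of the woman in position `var 0` to the front of the list of man `var 1` is made if
it leaves his partner unchanged. -/
def attempt : Stmt :=
  .seq copyMoved (.seq deferredAcceptance
    (.ite (.const 0) (.load (.add strategic (.var 1)))
      (.ite (.const 0) (.load (.add rejections (.var 1)))
        (.ite (.load (.add rejections (.var 1))) (.add (.var 0) (.const 1))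
          (copy lists tentative) .skip) .skip) .skip))

/-- The whole algorithm. -/
def equilibrium : Stmt :=
  .seq computeRanks (.seq (.loop (.loop (.loop (.loop attempt))))
    (.seq (copy tentative lists) (copy (.const 0) tentative)))

/-! ### Correctness of the program -/

variable {n : ℕ}

theorem run_copy {dst src : Expr} {D S : ℕ} (hd : ∀ env mem, dst.eval n env mem = D)
    (hs : ∀ env mem, src.eval n env mem = S) (hDS : D + n * n ≤ S ∨ S + n * n ≤ D)
    {f : Fin n → Fin n → ℕ} {mem : ℕ → ℕ} (hf : HoldsTable S f mem) (env : List ℕ) :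
    HoldsTable D f ((copy dst src).run n env mem) ∧
      EqOutside D (n * n) mem ((copy dst src).run n env mem) := by
  refine forLoop_table (fun _ => Equiv.refl _) f (fun i j mem' he => ?_)
  have := hf.congr he (by omega) i j
  simp [run, Expr.eval, cell, hd, hs, this]

/-- Writing `k` into column `women w k` tabulates the inverse permutation. The table replaces the
beneficiary matrix of the input, which the algorithm does not consult. -/
theorem run_computeRanks {women : Fin n → PrefList n} {mem : ℕ → ℕ}
    (h : HoldsTable (1 + n * n) (fun w k => (women w k : ℕ)) mem) (env : List ℕ) :
    HoldsTable (1 + n * n + n * n + n) (fun w m => ((women w).symm m : ℕ))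
        (computeRanks.run n env mem) ∧
      EqOutside (1 + n * n + n * n + n) (n * n) mem (computeRanks.run n env mem) := by
  refine forLoop_table women (fun _ k => (k : ℕ)) (fun w k mem' he => ?_)
  have := h.congr he (by omega) w k
  simp [run, Expr.eval, cell, ranks, tentative, strategic, this]

theorem run_copyMoved {p : Fin n → PrefList n} {mem : ℕ → ℕ}
    (h : HoldsTable 1 (fun m k => (p m k : ℕ)) mem) (m k : Fin n) (env : List ℕ) :
    HoldsTable (1 + n * n) (fun c j => (OneForManyGame.moveToFront m k p c j : ℕ))
        (copyMoved.run n (k :: m :: env) mem) ∧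
      EqOutside (1 + n * n) (n * n) mem (copyMoved.run n (k :: m :: env) mem) := by
  refine forLoop_table (fun _ => Equiv.refl _)
    (fun c j => (OneForManyGame.moveToFront m k p c j : ℕ)) (fun i j mem' he => ?_)
  have hf := h.congr he (by omega)
  have h1 := hf i j
  have h2 := hf m k
  by_cases him : i = m
  · subst him
    rw [OneForManyGame.moveToFront_self, PrefList.toFront_apply]
    by_cases hj : (j : ℕ) = 0
    · simp [run, Expr.eval, cell, lists, tentative, h2, hj]
    have hj' : ¬ (j : ℕ) < 1 := by omega
    by_cases hk : j ≤ k
    · have h3 := hf i ⟨j - 1, by omega⟩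
      -- The program has no subtraction: position `j - 1` in the table at `1` is read as position
      -- `j` in a table at `0`.
      rw [show 1 + (n * (i : ℕ) + (j - 1 : ℕ)) = n * i + j by omega] at h3
      simp [run, Expr.eval, cell, lists, tentative, h3, hj, hk]
    · simp [run, Expr.eval, cell, lists, tentative, h1, hj, hk, not_le.1 hk]
  · rw [OneForManyGame.moveToFront_of_ne him]
    rcases lt_or_gt_of_ne him with hlt | hlt
    · simp [run, Expr.eval, cell, lists, tentative, h1, hlt]
    · simp [run, Expr.eval, cell, lists, tentative, h1, hlt]

open DeferredAcceptance in
-- `Reachable` supplies `rej m < n`, which keeps the addresses that are read inside the row of the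
-- man.
theorem run_rejectOne {men women : Fin n → PrefList n} {rej : Fin n → ℕ} {mem : ℕ → ℕ}
    (hR : Reachable men women rej)
    (hrej : HoldsVec (1 + n * n + n * n + n + n * n) rej mem)
    (hmen : HoldsTable (1 + n * n) (fun m k => (men m k : ℕ)) mem)
    (hrank : HoldsTable (1 + n * n + n * n + n) (fun w m => ((women w).symm m : ℕ)) mem)
    (m m' : Fin n) (env : List ℕ) :
    HoldsVec (1 + n * n + n * n + n + n * n) (reject men women m m' rej)
        (rejectOne.run n (m' :: m :: env) mem) ∧
      EqOutside (1 + n * n + n * n + n + n * n) n mem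
        (rejectOne.run n (m' :: m :: env) mem) := by
  have ha := hmen m ⟨rej m, hR.lt m⟩
  have hb := hmen m' ⟨rej m', hR.lt m'⟩
  have hra := hrank (men m ⟨rej m, hR.lt m⟩) m
  have hrb := hrank (men m ⟨rej m, hR.lt m⟩) m'
  have hm := hrej m
  have hm' := hrej m'
  simp only at ha hb
  have hrun : rejectOne.run n (m' :: m :: env) mem =
      if men m' ⟨rej m', hR.lt m'⟩ < men m ⟨rej m, hR.lt m⟩ then mem else
      if men m ⟨rej m, hR.lt m⟩ < men m' ⟨rej m', hR.lt m'⟩ then mem else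
      if (women (men m ⟨rej m, hR.lt m⟩)).symm m' < (women (men m ⟨rej m, hR.lt m⟩)).symm m then
        Function.update mem (1 + n * n + n * n + n + n * n + m) (rej m + 1) else mem := by
    simp only [rejectOne, run, Expr.eval, cell, rejections, ranks, tentative, strategic,
      List.getD_cons_zero, List.getD_cons_succ, hm, hm', ha, hb, hra, hrb, Fin.lt_def]
  rw [hrun]
  unfold reject
  have hiff : (∃ w, proposal men rej m = some w ∧ proposal men rej m' = some w ∧
      (women w).Prefers m' m) ↔
      men m ⟨rej m, hR.lt m⟩ = men m' ⟨rej m', hR.lt m'⟩ ∧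
      (women (men m ⟨rej m, hR.lt m⟩)).symm m' < (women (men m ⟨rej m, hR.lt m⟩)).symm m := by
    simp only [proposal, dif_pos (hR.lt _), Option.some_inj]
    constructor
    · rintro ⟨w, rfl, h2, h3⟩
      exact ⟨h2.symm, h3⟩
    · rintro ⟨h2, h3⟩
      exact ⟨_, rfl, h2.symm, h3⟩
  simp only [hiff]
  have hmlt := m.isLt
  generalize men m ⟨rej m, hR.lt m⟩ = a, men m' ⟨rej m', hR.lt m'⟩ = b
  rcases lt_trichotomy a b with hlt | rfl | hlt
  · rw [if_neg hlt.not_gt, if_pos hlt, if_neg fun h : a = b ∧ _ => hlt.ne h.1]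
    exact ⟨hrej, EqOutside.refl _ _ _⟩
  · simp only [lt_irrefl, if_false, true_and]
    split_ifs
    · refine ⟨fun i => ?_, EqOutside.update _ _ (by omega)⟩
      by_cases hi : i = m
      · subst hi; rw [Function.update_self, Function.update_self]
      · rw [Function.update_of_ne hi, Function.update_of_ne, hrej i]
        exact fun h => hi (Fin.ext (Nat.add_left_cancel h))
    · exact ⟨hrej, EqOutside.refl _ _ _⟩
  · rw [if_pos hlt, if_neg fun h : a = b ∧ _ => hlt.ne' h.1]
    exact ⟨hrej, EqOutside.refl _ _ _⟩

open DeferredAcceptance in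
theorem run_deferredAcceptance {men women : Fin n → PrefList n} {mem : ℕ → ℕ}
    (hmen : HoldsTable (1 + n * n) (fun m k => (men m k : ℕ)) mem)
    (hrank : HoldsTable (1 + n * n + n * n + n) (fun w m => ((women w).symm m : ℕ)) mem)
    (env : List ℕ) :
    HoldsVec (1 + n * n + n * n + n + n * n) (final men women)
        (deferredAcceptance.run n env mem) ∧
      EqOutside (1 + n * n + n * n + n + n * n) n mem (deferredAcceptance.run n env mem) := by
  set R : (Fin n → ℕ) → (ℕ → ℕ) → Prop := fun rej mem' => Reachable men women rej ∧
    HoldsVec (1 + n * n + n * n + n + n * n) rej mem' ∧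
    EqOutside (1 + n * n + n * n + n + n * n) n mem mem' with hRdef
  have hreset := forLoop_induction (k := n) (x := mem)
    (f := fun i => (Stmt.store (.add rejections (.var 0)) (.const 0)).run n (i :: env))
    (fun k mem' => EqOutside (1 + n * n + n * n + n + n * n) n mem mem' ∧
      ∀ i < k, mem' (1 + n * n + n * n + n + n * n + i) = 0)
    ⟨EqOutside.refl _ _ _, fun i hi => absurd hi (Nat.not_lt_zero _)⟩ (by
      intro k hk mem' ⟨h1, h2⟩
      simp only [run, Expr.eval, rejections, ranks, strategic, tentative, List.getD_cons_zero]
      refine ⟨h1.trans (EqOutside.update _ _ (by omega)), fun i hi => ?_⟩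
      by_cases hik : i = k
      · subst hik; rw [Function.update_self]
      · rw [Function.update_of_ne (by omega), h2 i (by omega)])
  have h0 : R (fun _ => 0) ((Stmt.loop (.store (.add rejections (.var 0)) (.const 0))).run n env
      mem) := ⟨reachable_zero men women, fun i => hreset.2 i i.isLt, hreset.1⟩
  have hsweep : ∀ env rej mem', R rej mem' → R (rejectSweep men women rej)
      ((Stmt.loop (.loop rejectOne)).run n env mem') := by
    intro env rej mem' h
    refine finLoop_simulation R (fun m rej mem' h => ?_) h
    refine finLoop_simulation R (fun m' rej mem' h => ?_) h
    obtain ⟨h1, h2, h3⟩ := h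
    have := run_rejectOne h1 h2 (hmen.congr h3 (by omega)) (hrank.congr h3 (by omega)) m m' env
    exact ⟨h1.reject m m', this.1, h3.trans this.2⟩
  -- The two outer loops of `n` rounds amount to the `n * n` sweeps of `iterate_rejectSweep`.
  have hall := forLoop_simulation_iterate R (f := (rejectSweep men women)^[n])
    (g := fun i => (Stmt.loop (.loop (.loop rejectOne))).run n (i :: env))
    (fun i rej mem' h => forLoop_simulation_iterate R (fun j => hsweep (j :: i :: env)) n h) n h0
  rw [← Function.iterate_mul, iterate_rejectSweep] at hall
  exact hall.2

/-- The memory holds the current profile and the data of the game. -/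
def HoldsProfile (G : OneForManyGame n) (p : Fin n → PrefList n) (mem : ℕ → ℕ) : Prop :=
  HoldsTable 1 (fun m k => (p m k : ℕ)) mem ∧
  HoldsVec (1 + n * n + n * n) (fun m => if m ∈ G.strategic then 1 else 0) mem ∧
  HoldsTable (1 + n * n + n * n + n) (fun w m => ((G.womenPref w).symm m : ℕ)) mem

/-- The tentative lists and the rejection counts are scratch space, recomputed in every attempt, and
therefore not part of `HoldsProfile`. -/
theorem HoldsProfile.run_attempt {G : OneForManyGame n} {p : Fin n → PrefList n} {mem : ℕ → ℕ}
    (h : HoldsProfile G p mem) (m k : Fin n) (env : List ℕ) :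
    HoldsProfile G (G.attempt m k p) (attempt.run n (k :: m :: env) mem) := by
  obtain ⟨h1, h2, h3⟩ := h
  obtain ⟨hc, hce⟩ := run_copyMoved h1 m k env
  set mem₁ := copyMoved.run n (k :: m :: env) mem with hmem₁
  replace h1 := h1.congr hce (by omega)
  replace h2 := h2.congr hce (by omega)
  replace h3 := h3.congr hce (by omega)
  obtain ⟨hd, hde⟩ := run_deferredAcceptance hc h3 (k :: m :: env)
  set mem₂ := deferredAcceptance.run n (k :: m :: env) mem₁ with hmem₂
  replace h1 := h1.congr hde (by omega)
  replace h2 := h2.congr hde (by omega)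
  replace h3 := h3.congr hde (by omega)
  replace hc := hc.congr hde (by omega)
  have hrun : attempt.run n (k :: m :: env) mem =
      if m ∈ G.strategic ∧ 0 < G.rejections (OneForManyGame.moveToFront m k p) m ∧
        G.rejections (OneForManyGame.moveToFront m k p) m ≤ k then
        (copy lists tentative).run n (k :: m :: env) mem₂ else mem₂ := by
    have hs := h2 m
    have hr := hd m
    simp only [attempt, run, ← hmem₁, ← hmem₂, Expr.eval, rejections, ranks, strategic, tentative,
      List.getD_cons_zero, List.getD_cons_succ, hs, hr, Nat.lt_succ_iff]
    change _ = if _ ∧ 0 < DeferredAcceptance.final _ _ m ∧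
      DeferredAcceptance.final _ _ m ≤ _ then _ else _
    by_cases g1 : m ∈ G.strategic
    swap
    · simp [g1]
    by_cases g2 : 0 < DeferredAcceptance.final (OneForManyGame.moveToFront m k p) G.womenPref m
    swap
    · simp [g1, g2]
    simp [g1, g2]
  rw [hrun]
  unfold OneForManyGame.attempt
  split_ifs with hif
  swap
  · exact ⟨h1, h2, h3⟩
  obtain ⟨hp, hpe⟩ := run_copy (dst := lists) (src := tentative) (D := 1) (S := 1 + n * n)
    (fun _ _ => rfl) (fun _ _ => rfl) (by omega) hc (k :: m :: env)
  exact ⟨hp, h2.congr hpe (by omega), h3.congr hpe (by omega)⟩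

theorem run_equilibrium {G : OneForManyGame n} {mem : ℕ → ℕ}
    (h1 : HoldsTable 1 (fun m k => (G.menPref m k : ℕ)) mem)
    (h2 : HoldsTable (1 + n * n) (fun w k => (G.womenPref w k : ℕ)) mem)
    (h3 : HoldsVec (1 + n * n + n * n) (fun m => if m ∈ G.strategic then 1 else 0) mem) :
    HoldsTable 0 (fun m k => (G.equilibrium m k : ℕ)) (equilibrium.run n [] mem) := by
  obtain ⟨hr, hre⟩ := run_computeRanks h2 []
  have h0 : HoldsProfile G G.menPref (computeRanks.run n [] mem) :=
    ⟨h1.congr hre (by omega), h3.congr hre (by omega), hr⟩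
  have hsweep : ∀ env p mem, HoldsProfile G p mem → HoldsProfile G (G.attemptSweep p)
      ((Stmt.loop (.loop attempt)).run n env mem) := fun env p mem h =>
    finLoop_simulation (HoldsProfile G) (fun m p mem h =>
      finLoop_simulation (HoldsProfile G) (fun k p mem h => h.run_attempt m k env) h) h
  have hall := forLoop_simulation_iterate (HoldsProfile G) (f := G.attemptSweep^[n])
    (g := fun i => (Stmt.loop (.loop (.loop attempt))).run n [i])
    (fun i p mem h => forLoop_simulation_iterate (HoldsProfile G) (fun j => hsweep [j, i]) n h)
    n h0
  rw [← Function.iterate_mul] at hall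
  -- The lists at `1` overlap with the output area at `0`, so they are copied by way of the
  -- tentative table.
  obtain ⟨hp, -⟩ := run_copy (dst := tentative) (src := lists) (D := 1 + n * n) (S := 1)
    (fun _ _ => rfl) (fun _ _ => rfl) (by omega) hall.1 []
  exact (run_copy (dst := .const 0) (src := tentative) (D := 0) (S := 1 + n * n)
    (fun _ _ => rfl) (fun _ _ => rfl) (by omega) hp []).1

end Stmt

/-! ### Input and output -/

theorem divNat_index {n : ℕ} (i j : Fin n) :
    (⟨n * i + j, index_lt i.isLt j.isLt⟩ : Fin (n * n)).divNat = i := by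
  have := i.isLt
  ext
  rw [Fin.coe_divNat, Nat.mul_add_div (by omega), Nat.div_eq_of_lt j.isLt, Nat.add_zero]

theorem modNat_index {n : ℕ} (i j : Fin n) :
    (⟨n * i + j, index_lt i.isLt j.isLt⟩ : Fin (n * n)).modNat = j := by
  ext
  rw [Fin.coe_modNat, Nat.mul_add_mod, Nat.mod_eq_of_lt j.isLt]

theorem index_divNat_modNat {n : ℕ} (i : Fin (n * n)) : n * (i.divNat : ℕ) + i.modNat = i := by
  rw [Fin.coe_divNat, Fin.coe_modNat, Nat.div_add_mod]

theorem holds_encode {n : ℕ} (G : OneForManyGame n) :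
    HoldsTable 1 (fun m k => (G.menPref m k : ℕ)) (initial G.encode).mem ∧
    HoldsTable (1 + n * n) (fun w k => (G.womenPref w k : ℕ)) (initial G.encode).mem ∧
    HoldsVec (1 + n * n + n * n) (fun m => if m ∈ G.strategic then 1 else 0)
      (initial G.encode).mem := by
  have hmem : ∀ a, (initial G.encode).mem (1 + a) = G.encode.tail.getD a 0 := fun a => by
    rw [Nat.add_comm]; rfl
  refine ⟨fun i j => ?_, fun i j => ?_, fun i => ?_⟩
  · have := index_lt i.isLt j.isLt
    rw [hmem, OneForManyGame.encode, List.tail_cons,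
      List.getD_append _ _ _ _ (by simp; omega), List.getD_append _ _ _ _ (by simp; omega),
      List.getD_append _ _ _ _ (by simpa using this),
      List.getD_eq_getElem _ _ (by simpa using this), List.getElem_ofFn, divNat_index,
      modNat_index]
  · have := index_lt i.isLt j.isLt
    rw [Nat.add_assoc, hmem, OneForManyGame.encode, List.tail_cons,
      List.getD_append _ _ _ _ (by simp; omega), List.getD_append _ _ _ _ (by simp; omega),
      List.getD_append_right _ _ _ _ (by simp)]
    simp only [List.length_ofFn, Nat.add_sub_cancel_left]
    rw [List.getD_eq_getElem _ _ (by simpa using this), List.getElem_ofFn, divNat_index,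
      modNat_index]
  · have := i.isLt
    rw [Nat.add_assoc, Nat.add_assoc, hmem, OneForManyGame.encode, List.tail_cons,
      List.getD_append _ _ _ _ (by simp),
      List.getD_append_right _ _ _ _ (by simp)]
    simp only [List.length_ofFn, List.length_append]
    rw [← Nat.add_assoc, Nat.add_sub_cancel_left, List.getD_eq_getElem _ _ (by simp),
      List.getElem_ofFn]

end RAM

/-! ### Assembly of the main theorem -/

theorem getElem_encodeProfile {n i : ℕ} (p : Man n → PrefList n)
    (h : i < (encodeProfile p).length) (hi : i < n * n) :
    (encodeProfile p)[i] = (p (Fin.divNat ⟨i, hi⟩) (Fin.modNat ⟨i, hi⟩) : ℕ) := by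
  simp [encodeProfile]

theorem mainTheorem5 :
    ComputableInPolyTime (fun _ G p => G.IsNashEquilibrium p) ∧
    ∀ (n : ℕ) (G : OneForManyGame n), ∃ p : Man n → PrefList n,
      G.IsNashEquilibrium p ∧ IsStable G.menPref G.womenPref (G.outcome p) := by
  refine ⟨?_, fun n G => ⟨G.equilibrium, G.isNashEquilibrium_equilibrium,
    G.truthfulBelow_equilibrium.isStable⟩⟩
  obtain ⟨c, q, h⟩ := RAM.Stmt.equilibrium.exists_program
  refine ⟨c, q, fun n G => ?_⟩
  obtain ⟨t, u, h1, h2, h3⟩ := h n G.encode.tail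
  refine ⟨t, u, G.equilibrium, h1, h2, fun i hi => ?_, G.isNashEquilibrium_equilibrium⟩
  obtain ⟨g1, g2, g3⟩ := RAM.holds_encode G
  have hi' : i < n * n := by simpa [encodeProfile] using hi
  have := RAM.Stmt.run_equilibrium g1 g2 g3 (Fin.divNat ⟨i, hi'⟩) (Fin.modNat ⟨i, hi'⟩)
  rw [RAM.index_divNat_modNat, Nat.zero_add] at this
  rw [h3]
  exact this.trans (getElem_encodeProfile _ hi hi').symm
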